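/- **Setting.** Let $\mathsf{IRIs}$, $\mathsf{Literals}$, $\mathsf{Blanks}$ be disjoint countable sets, whose union is the set of terms, let $\mathsf{Names}$ be a countable set of shape names, and let finitely many value types $t$ be given, each with a set $[\![t]\!]$ of terms. Elements of each of these four countable sets are represented by distinct binary words (via any fixed injective coding). An RDF graph is a finite set $\mathcal G$ of triples in $(\mathsf{IRIs}\cup\mathsf{Blanks})\times\mathsf{IRIs}\times(\mathsf{IRIs}\cup\mathsf{Blanks}\cup\mathsf{Literals})$; $\mathsf{Nodes}(\mathcal G)$ is the set of its subjects and objects. ShEx shapes $\varphi$, triple expressions $e$ and closed triple expressions $f$ are given by $$\varphi ::= \mathsf{test}(c)\mid \mathsf{test}(t)\mid s\mid \{e\}\mid \varphi\wedge\varphi\mid\varphi\vee\varphi\mid\neg\varphi,$$ $$e ::= f\,;(\neg R^-)^*\ \mid\ f\,;(\neg R^-)^*;(\neg Q)^*,\qquad f ::= \varepsilon\mid p.\varphi\mid p^-.\varphi\mid f;f\mid f|f\mid f^*,$$ with $c\in\mathsf{IRIs}\cup\mathsf{Literals}$, $t$ a value type, $s\in\mathsf{Names}$, $p\in\mathsf{IRIs}$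 and $R,Q\subseteq\mathsf{IRIs}$ finite. A catalogue $\mathcal C$ is a partial function with finite domain $\mathrm{dom}(\mathcal C)$ from shape names to shapes, such that all shape names appearing in its shapes are in $\mathrm{dom}(\mathcal C)$; $\mathsf{Const}(\mathcal C)$ is the set of $c$ such that $\mathsf{test}(c)$ appears in $\mathcal C$. A shape assignment for $\mathcal G$ and $\mathcal C$ is a relation $\alpha\subseteq \mathrm{dom}(\mathcal C)\times(\mathsf{Nodes}(\mathcal G)\cup\mathsf{Const}(\mathcal C))$. A triple expression is *shallow* if in each of its subexpressions $p.\varphi$ and $p^-.\varphi$ the shape $\varphi$ is a shape name. The neighbourhood $\mathsf{Neigh}^\pm_{\mathcal G}(v)$ consists of the edges $(v,p,v')\in\mathcal G$ and of the inverse edges $(v,p^-,v')$ with $(v',p,v)\in\mathcal G$. The family $[\![e]\!]^{\mathcal G}_\alpha$ of sets of edges and inverse edges of $\mathcal G$ matching $e$ is defined as follows, together with the sets $[\![\varphi]\!]^{\mathcal G}_\alpha\subseteq\mathsf{Nodes}(\mathcal G)\cup\mathsf{Const}(\mathcal C)$: we have $[\![\mathsf{test}(c)]\!]^{\mathcal G}_\alpha=\{c\}$;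 $[\![\mathsf{test}(t)]\!]^{\mathcal G}_\alpha=[\![t]\!]\cap(\mathsf{Nodes}(\mathcal G)\cup\mathsf{Const}(\mathcal C))$; $[\![s]\!]^{\mathcal G}_\alpha=\{u\mid (s,u)\in\alpha\}$; $\{e\}$ denotes the set of $u\in\mathsf{Nodes}(\mathcal G)\cup\mathsf{Const}(\mathcal C)$ with $\mathsf{Neigh}^\pm_{\mathcal G}(u)\in[\![e]\!]^{\mathcal G}_\alpha$; Boolean connectives are interpreted in $\mathsf{Nodes}(\mathcal G)\cup\mathsf{Const}(\mathcal C)$. Further, $\varepsilon$ matches $\emptyset$; $p.\varphi$ (resp. $p^-.\varphi$) matches the singletons $\{(u,p,w)\}$ (resp. $\{(u,p^-,w)\}$) with $w\in[\![\varphi]\!]^{\mathcal G}_\alpha$; $f_1|f_2$ matches what $f_1$ or $f_2$ matches; $f_1;f_2$ matches the unions of two disjoint sets matched by $f_1$ and $f_2$ respectively; $f^*$ matches the unions of arbitrarily many (possibly zero) pairwise disjoint sets matched by $f$; $(\neg Q)^*$ matches all sets of $p$-edges with $p\notin Q$, and $(\neg R^-)^*$ all sets of $p^-$-edges with $p\notin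 R$. **Proposition.** Fix a catalogue $\mathcal C$ and a shallow triple expression $e$ occurring in $\mathcal C$. There is a deterministic polynomial-time (multi-tape Turing machine) algorithm that, given as input a graph $\mathcal G$, a shape assignment $\alpha$ for $\mathcal G$ and $\mathcal C$ (both listed without repetition, in any order), and a node $v\in\mathsf{Nodes}(\mathcal G)\cup\mathsf{Const}(\mathcal C)$, decides whether $\mathsf{Neigh}^\pm_{\mathcal G}(v)\in[\![e]\!]^{\mathcal G}_\alpha$. The time is measured in the length of the encoded input. -/

import Mathlib

namespace ShEx

/-! ### RDF graphs

`I`, `L`, `B` are the sets of IRIs, literals and blank nodes. -/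

/-- RDF terms: the disjoint union of the IRIs, the literals and the blank nodes. -/
inductive Term (I L B : Type) : Type
  | iri (i : I)
  | lit (l : L)
  | blank (b : B)

/-- A triple of an RDF graph. The subject is an IRI or a blank node, the predicate is an IRI, the
object is an arbitrary term. -/
@[ext] structure Triple (I L B : Type) : Type where
  subj : I ⊕ B
  pred : I
  obj : Term I L B

/-- The subject of a triple, as a term. -/
def Triple.source {I L B : Type} (t : Triple I L B) : Term I L B :=
  Sum.elim Term.iri Term.blank t.subj

/-- An RDF graph is a finite set of triples. -/
abbrev Graph (I L B : Type) : Type := Finset (Triple I L B)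

/-- The nodes of a graph: the terms in subject or object position of some triple. -/
def Graph.nodes {I L B : Type} (G : Graph I L B) : Set (Term I L B) :=
  {u | ∃ t ∈ G, u = t.source ∨ u = t.obj}

/-- A predicate `p` or an inverse predicate `p⁻`. -/
inductive Dir (I : Type) : Type
  | fwd (p : I)
  | inv (p : I)

/-- Edges `(u, p, w)` and inverses of edges `(u, p⁻, w)`. -/
@[ext] structure Edge (I L B : Type) : Type where
  src : Term I L B
  dir : Dir I
  tgt : Term I L B

/-- The edge `(u, p, w)` given by the triple `(u, p, w)`. -/
def Triple.edge {I L B : Type} (t : Triple I L B) : Edge I L B :=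
  ⟨t.source, Dir.fwd t.pred, t.obj⟩

/-- The inverse `(w, p⁻, u)` of the edge given by the triple `(u, p, w)`. -/
def Triple.invEdge {I L B : Type} (t : Triple I L B) : Edge I L B :=
  ⟨t.obj, Dir.inv t.pred, t.source⟩

/-- All edges and inverses of edges of a graph. -/
def Graph.edges {I L B : Type} (G : Graph I L B) : Set (Edge I L B) :=
  {x | ∃ t ∈ G, x = t.edge ∨ x = t.invEdge}

/-- The neighbourhood of `v`: the edges outgoing from `v` and the inverses of the edges incoming
to `v`. -/
def Graph.neigh {I L B : Type} (G : Graph I L B) (v : Term I L B) : Set (Edge I L B) :=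
  {x | x ∈ G.edges ∧ x.src = v}

/-! ### Syntax

`V` is the set of value types and `N` the set of shape names. -/

mutual

/-- Shapes. -/
inductive Shape (I L V N : Type) : Type
  | testConst (c : I ⊕ L)
  | testType (t : V)
  | name (s : N)
  | neigh (e : TripleExpr I L V N)
  | and (φ ψ : Shape I L V N)
  | or (φ ψ : Shape I L V N)
  | not (φ : Shape I L V N)

/-- Triple expressions: `invOpen f R` is `f ; (¬R⁻)*` and `open_ f R Q` is
`f ; (¬R⁻)* ; (¬Q)*`. -/
inductive TripleExpr (I L V N : Type) : Type
  | invOpen (f : ClosedExpr I L V N) (R : Finset I)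
  | open_ (f : ClosedExpr I L V N) (R Q : Finset I)

/-- Closed triple expressions: `ε`, `p.φ`, `p⁻.φ`, `f ; g`, `f | g`, `f*`. -/
inductive ClosedExpr (I L V N : Type) : Type
  | eps
  | edge (p : I) (φ : Shape I L V N)
  | invEdge (p : I) (φ : Shape I L V N)
  | seq (f g : ClosedExpr I L V N)
  | alt (f g : ClosedExpr I L V N)
  | star (f : ClosedExpr I L V N)

end

mutual

/-- The shape names that appear in a shape. -/
def Shape.names {I L V N : Type} : Shape I L V N → Set N
  | .testConst _ => ∅
  | .testType _ => ∅
  | .name s => {s}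
  | .neigh e => e.names
  | .and φ ψ => φ.names ∪ ψ.names
  | .or φ ψ => φ.names ∪ ψ.names
  | .not φ => φ.names

/-- The shape names that appear in a triple expression. -/
def TripleExpr.names {I L V N : Type} : TripleExpr I L V N → Set N
  | .invOpen f _ => f.names
  | .open_ f _ _ => f.names

/-- The shape names that appear in a closed triple expression. -/
def ClosedExpr.names {I L V N : Type} : ClosedExpr I L V N → Set N
  | .eps => ∅
  | .edge _ φ => φ.names
  | .invEdge _ φ => φ.names
  | .seq f g => f.names ∪ g.names
  | .alt f g => f.names ∪ g.names
  | .star f => f.names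

end

mutual

/-- The constants `c` such that `test(c)` appears in a shape. -/
def Shape.consts {I L V N : Type} : Shape I L V N → Set (I ⊕ L)
  | .testConst c => {c}
  | .testType _ => ∅
  | .name _ => ∅
  | .neigh e => e.consts
  | .and φ ψ => φ.consts ∪ ψ.consts
  | .or φ ψ => φ.consts ∪ ψ.consts
  | .not φ => φ.consts

/-- The constants `c` such that `test(c)` appears in a triple expression. -/
def TripleExpr.consts {I L V N : Type} : TripleExpr I L V N → Set (I ⊕ L)
  | .invOpen f _ => f.consts
  | .open_ f _ _ => f.consts

/-- The constants `c` such that `test(c)` appears in a closed triple expression. -/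
def ClosedExpr.consts {I L V N : Type} : ClosedExpr I L V N → Set (I ⊕ L)
  | .eps => ∅
  | .edge _ φ => φ.consts
  | .invEdge _ φ => φ.consts
  | .seq f g => f.consts ∪ g.consts
  | .alt f g => f.consts ∪ g.consts
  | .star f => f.consts

end

mutual

/-- The triple expressions that occur in a shape, at any depth. -/
def Shape.tripleExprs {I L V N : Type} : Shape I L V N → Set (TripleExpr I L V N)
  | .testConst _ => ∅
  | .testType _ => ∅
  | .name _ => ∅
  | .neigh e => e.tripleExprs
  | .and φ ψ => φ.tripleExprs ∪ ψ.tripleExprs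
  | .or φ ψ => φ.tripleExprs ∪ ψ.tripleExprs
  | .not φ => φ.tripleExprs

/-- The triple expressions that occur in a triple expression, itself included. -/
def TripleExpr.tripleExprs {I L V N : Type} : TripleExpr I L V N → Set (TripleExpr I L V N)
  | .invOpen f R => insert (.invOpen f R) f.tripleExprs
  | .open_ f R Q => insert (.open_ f R Q) f.tripleExprs

/-- The triple expressions that occur in the shapes of a closed triple expression. -/
def ClosedExpr.tripleExprs {I L V N : Type} : ClosedExpr I L V N → Set (TripleExpr I L V N)
  | .eps => ∅
  | .edge _ φ => φ.tripleExprs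
  | .invEdge _ φ => φ.tripleExprs
  | .seq f g => f.tripleExprs ∪ g.tripleExprs
  | .alt f g => f.tripleExprs ∪ g.tripleExprs
  | .star f => f.tripleExprs

end

/-- A closed triple expression is shallow if in each `p.φ` and each `p⁻.φ` the shape `φ` is a shape
name. -/
def ClosedExpr.IsShallow {I L V N : Type} : ClosedExpr I L V N → Prop
  | .eps => True
  | .edge _ φ => ∃ s, φ = .name s
  | .invEdge _ φ => ∃ s, φ = .name s
  | .seq f g => f.IsShallow ∧ g.IsShallow
  | .alt f g => f.IsShallow ∧ g.IsShallow
  | .star f => f.IsShallow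

/-- Shallow triple expressions. -/
def TripleExpr.IsShallow {I L V N : Type} : TripleExpr I L V N → Prop
  | .invOpen f _ => f.IsShallow
  | .open_ f _ _ => f.IsShallow

/-- A ShEx catalogue: a partial function from shape names to shapes with finite domain, such that
every shape name that appears in one of its shapes is declared. -/
structure Catalogue (I L V N : Type) : Type where
  decl : N → Option (Shape I L V N)
  finite_dom : {s | (decl s).isSome}.Finite
  names_declared : ∀ s φ, decl s = some φ → ∀ t ∈ φ.names, (decl t).isSome

/-- The declared shape names. -/
def Catalogue.dom {I L V N : Type} (C : Catalogue I L V N) : Set N :=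
  {s | (C.decl s).isSome}

/-- The constants tested in a catalogue, as terms. -/
def Catalogue.consts {I L V N : Type} (B : Type) (C : Catalogue I L V N) : Set (Term I L B) :=
  {u | ∃ s φ, C.decl s = some φ ∧ ∃ c ∈ φ.consts, u = Sum.elim Term.iri Term.lit c}

/-- The triple expressions that occur in a catalogue. -/
def Catalogue.tripleExprs {I L V N : Type} (C : Catalogue I L V N) : Set (TripleExpr I L V N) :=
  {e | ∃ s φ, C.decl s = some φ ∧ e ∈ φ.tripleExprs}

/-- `Nodes(G) ∪ Const(C)`. -/
def universeOf {I L B V N : Type} (C : Catalogue I L V N) (G : Graph I L B) : Set (Term I L B) :=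
  G.nodes ∪ C.consts B

/-- `α` is a shape assignment for `C` and `G`. -/
def IsShapeAssignment {I L B V N : Type} (C : Catalogue I L V N) (G : Graph I L B)
    (α : Set (N × Term I L B)) : Prop :=
  α ⊆ C.dom ×ˢ universeOf C G

/-! ### Semantics -/

/-- The unions of two disjoint sets, one from each family. -/
def disjointUnions {E : Type} (𝓐 𝓑 : Set (Set E)) : Set (Set E) :=
  {X | ∃ F₁ ∈ 𝓐, ∃ F₂ ∈ 𝓑, Disjoint F₁ F₂ ∧ X = F₁ ∪ F₂}

/-- The unions of arbitrarily many (possibly zero) pairwise disjoint members of a family. -/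
def disjointStar {E : Type} (𝓐 : Set (Set E)) : Set (Set E) :=
  {X | ∃ l : List (Set E), (∀ F ∈ l, F ∈ 𝓐) ∧ l.Pairwise Disjoint ∧ X = ⋃₀ {F | F ∈ l}}

/-- The sets matched by `(¬Q)*`: arbitrary sets of `p`-edges of `G` with `p ∉ Q`. -/
def fwdOutside {I L B : Type} (G : Graph I L B) (Q : Finset I) : Set (Set (Edge I L B)) :=
  {X | ∀ x ∈ X, ∃ t ∈ G, x = t.edge ∧ t.pred ∉ Q}

/-- The sets matched by `(¬R⁻)*`: arbitrary sets of `p⁻`-edges of `G` with `p ∉ R`. -/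
def invOutside {I L B : Type} (G : Graph I L B) (R : Finset I) : Set (Set (Edge I L B)) :=
  {X | ∀ x ∈ X, ∃ t ∈ G, x = t.invEdge ∧ t.pred ∉ R}

mutual

/-- The semantics of a shape in the catalogue `C` on the graph `G` under the assignment `α`, where
`val` interprets the value types. -/
def Shape.sem {I L B V N : Type} (val : V → Set (Term I L B)) (C : Catalogue I L V N)
    (G : Graph I L B) (α : Set (N × Term I L B)) : Shape I L V N → Set (Term I L B)
  | .testConst c => {Sum.elim Term.iri Term.lit c}
  | .testType t => val t ∩ universeOf C G
  | .name s => {u | (s, u) ∈ α}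
  | .neigh e => {u | u ∈ universeOf C G ∧ G.neigh u ∈ e.sem val C G α}
  | .and φ ψ => φ.sem val C G α ∩ ψ.sem val C G α
  | .or φ ψ => φ.sem val C G α ∪ ψ.sem val C G α
  | .not φ => universeOf C G \ φ.sem val C G α

/-- The family of sets of edges and inverses of edges of `G` that match a triple expression. -/
def TripleExpr.sem {I L B V N : Type} (val : V → Set (Term I L B)) (C : Catalogue I L V N)
    (G : Graph I L B) (α : Set (N × Term I L B)) :
    TripleExpr I L V N → Set (Set (Edge I L B))
  | .invOpen f R => disjointUnions (f.sem val C G α) (invOutside G R)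
  | .open_ f R Q =>
      disjointUnions (disjointUnions (f.sem val C G α) (invOutside G R)) (fwdOutside G Q)

/-- The family of sets of edges and inverses of edges of `G` that match a closed triple
expression. -/
def ClosedExpr.sem {I L B V N : Type} (val : V → Set (Term I L B)) (C : Catalogue I L V N)
    (G : Graph I L B) (α : Set (N × Term I L B)) :
    ClosedExpr I L V N → Set (Set (Edge I L B))
  | .eps => {∅}
  | .edge p φ => {X | ∃ t ∈ G, t.pred = p ∧ t.obj ∈ φ.sem val C G α ∧ X = {t.edge}}
  | .invEdge p φ => {X | ∃ t ∈ G, t.pred = p ∧ t.source ∈ φ.sem val C G α ∧ X = {t.invEdge}}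
  | .seq f g => disjointUnions (f.sem val C G α) (g.sem val C G α)
  | .alt f g => f.sem val C G α ∪ g.sem val C G α
  | .star f => disjointStar (f.sem val C G α)

end

/-! ### The decision problem and the encoding of its inputs -/

/-- An input: a graph and a shape assignment, each given by a list of its elements in an arbitrary
order, and a node. -/
structure MatchInput {I L V N : Type} (B : Type) (C : Catalogue I L V N) : Type where
  triples : List (Triple I L B)
  triples_nodup : triples.Nodup
  pairs : List (N × Term I L B)
  pairs_nodup : pairs.Nodup
  node : Term I L B
  pairs_valid : IsShapeAssignment C (⟨triples, triples_nodup⟩ : Graph I L B) {x | x ∈ pairs}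
  node_valid : node ∈ universeOf C (⟨triples, triples_nodup⟩ : Graph I L B)

/-- The graph of an input. -/
def MatchInput.graph {I L B V N : Type} {C : Catalogue I L V N} (x : MatchInput B C) :
    Graph I L B :=
  ⟨x.triples, x.triples_nodup⟩

/-- The shape assignment of an input. -/
def MatchInput.assignment {I L B V N : Type} {C : Catalogue I L V N} (x : MatchInput B C) :
    Set (N × Term I L B) :=
  {y | y ∈ x.pairs}

/-- The question: does the neighbourhood of the node match the triple expression `e`? -/
def MatchInput.Matches {I L B V N : Type} (val : V → Set (Term I L B)) {C : Catalogue I L V N}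
    (e : TripleExpr I L V N) (x : MatchInput B C) : Prop :=
  x.graph.neigh x.node ∈ e.sem val C x.graph x.assignment

open Classical in
/-- The answer to the question, as a Boolean. -/
noncomputable def MatchInput.answer {I L B V N : Type} (val : V → Set (Term I L B))
    {C : Catalogue I L V N} (e : TripleExpr I L V N) (x : MatchInput B C) : Bool :=
  decide (x.Matches val e)

/-- The input alphabet: two bits, a tag for each kind of term, a tag for each kind of list entry,
and an end marker for words of bits. -/
inductive Sym : Type
  | bit (b : Bool)
  | iri
  | lit
  | blank
  | triple
  | pair
  | close
  deriving DecidableEq, Fintype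

/-- Representations of the IRIs, literals, blank nodes and shape names by distinct words of bits
(within each of the four kinds). -/
structure Coding (I L B N : Type) : Type where
  iri : I → List Bool
  lit : L → List Bool
  blank : B → List Bool
  name : N → List Bool
  iri_injective : Function.Injective iri
  lit_injective : Function.Injective lit
  blank_injective : Function.Injective blank
  name_injective : Function.Injective name

/-- A word of bits, followed by the end marker. -/
def encodeWord (w : List Bool) : List Sym := w.map Sym.bit ++ [Sym.close]

def encodeTerm {I L B N : Type} (κ : Coding I L B N) : Term I L B → List Sym
  | .iri i => Sym.iri :: encodeWord (κ.iri i)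
  | .lit l => Sym.lit :: encodeWord (κ.lit l)
  | .blank b => Sym.blank :: encodeWord (κ.blank b)

def encodeTriple {I L B N : Type} (κ : Coding I L B N) (t : Triple I L B) : List Sym :=
  Sym.triple :: (encodeTerm κ t.source ++ encodeWord (κ.iri t.pred) ++ encodeTerm κ t.obj)

def encodePair {I L B N : Type} (κ : Coding I L B N) (y : N × Term I L B) : List Sym :=
  Sym.pair :: (encodeWord (κ.name y.1) ++ encodeTerm κ y.2)

/-- The word over the input alphabet that represents an input: the node, then the triples of the
graph, then the pairs of the shape assignment. -/
def MatchInput.encode {I L B V N : Type} {C : Catalogue I L V N} (κ : Coding I L B N)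
    (x : MatchInput B C) : List Sym :=
  encodeTerm κ x.node ++ x.triples.flatMap (encodeTriple κ) ++ x.pairs.flatMap (encodePair κ)

end ShEx

set_option autoImplicit false

/-!
The neighbourhood of a node matches a shallow triple expression `e` or not depending only on how many
of its edges there are of each *type*. The type of an edge consists of its orientation, its predicate,
where all predicates that do not occur in `e` are identified, and the set of those names occurring in
`e` that the assignment gives to its target. As `e` is fixed, there are finitely many types. The matched
sets are the sets of edges whose vector of type counts lies in a fixed set of vectors
(`ShEx.neigh_mem_sem_iff`): an alternative becomes a union, `f ; g` a sum of sets of vectors, `f*` the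
generated submonoid, because a set can be split into disjoint parts with any prescribed type counts that
add up to its own. By induction this set of vectors is semilinear
(`ShEx.TripleExpr.isSemilinearSet_counts`), that is, a finite union of sets `a + ⟨p₁, …, pₖ⟩`.

A vector with entries at most `n` lies in `a + ⟨p₁, …, pₖ⟩` if and only if it equals `a + ∑ cᵢ pᵢ` with
all `cᵢ ≤ n`, so that `k` nested loops decide membership in time polynomial in `n`
(`ShEx.exists_search_of_isSemilinearSet`, `ShEx.runs_searchAll`). The types of the edges at the given
node are counted, in unary, by a pass over the triples, in which the subject and the object of each
triple are compared with the node and with the terms in the list of pairs (`ShEx.runs_countTriples`).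
The relevant predicates and names are recognized by a finite automaton (`ShEx.exists_automaton`).

The algorithm is written in a small language of structured programs over finitely many stacks, with a
big-step semantics `Prog.Runs` that bounds the number of steps. Programs are compiled to Turing machines
with finite stack alphabets, with one step of the machine for each step of the program and a last phase
that empties the stacks and writes the answer (`Prog.computableInPolyTime`).
-/

/-! ### Initial and final configurations of a machine -/

theorem Turing.initList_eq (tm : Turing.FinTM2) (l : List (tm.Γ tm.k₀)) :
    Turing.initList tm l =
      ⟨some tm.main, tm.initialState, Function.update (fun _ => []) tm.k₀ l⟩ := by
  unfold Turing.initList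
  congr 1
  funext k
  by_cases hk : k = tm.k₀
  · subst hk; simp
  · rw [dif_neg hk, Function.update_of_ne hk]

theorem Turing.haltList_eq (tm : Turing.FinTM2) (l : List (tm.Γ tm.k₁)) :
    Turing.haltList tm l = ⟨none, tm.initialState, Function.update (fun _ => []) tm.k₁ l⟩ := by
  unfold Turing.haltList
  congr 1
  funext k
  by_cases hk : k = tm.k₁
  · subst hk; simp
  · rw [dif_neg hk, Function.update_of_ne hk]

/-! ### Structured programs over stacks -/

/-- Structured programs over finitely many stacks with a common alphabet `A`, indexed by `K`, and a
finite control state in `σ`. The instruction `case` branches over the finite type `ι`. -/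
inductive Prog (K σ A ι : Type) : Type
  | load (f : σ → σ)
  | push (k : K) (f : σ → A)
  | pop (k : K) (f : σ → Option A → σ)
  | seq (P Q : Prog K σ A ι)
  | ite (f : σ → Bool) (P Q : Prog K σ A ι)
  | case (f : σ → ι) (P : ι → Prog K σ A ι)
  | loop (f : σ → Bool) (P : Prog K σ A ι)

namespace Prog

variable {K σ A ι : Type}

/-- Sequential composition of a list of programs. -/
def seqs (l : List (Prog K σ A ι)) : Prog K σ A ι :=
  l.foldr Prog.seq (.load id)

@[simp] theorem seqs_nil : seqs ([] : List (Prog K σ A ι)) = .load id := rfl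

@[simp] theorem seqs_cons (P : Prog K σ A ι) (l : List (Prog K σ A ι)) :
    seqs (P :: l) = .seq P (seqs l) := rfl

/-- The labels of the compiled program: one for each instruction. -/
def Lab : Prog K σ A ι → Type
  | .load _ => Unit
  | .push _ _ => Unit
  | .pop _ _ => Unit
  | .seq P Q => P.Lab ⊕ Q.Lab
  | .ite _ P Q => Option (P.Lab ⊕ Q.Lab)
  | .case _ P => Option (Σ i, (P i).Lab)
  | .loop _ P => Option P.Lab

theorem finite_lab [Finite ι] (P : Prog K σ A ι) : Finite P.Lab := by
  induction P with
  | load | push | pop => exact inferInstanceAs (Finite Unit)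
  | seq P Q hP hQ => exact inferInstanceAs (Finite (P.Lab ⊕ Q.Lab))
  | ite f P Q hP hQ => exact inferInstanceAs (Finite (Option (P.Lab ⊕ Q.Lab)))
  | case f P hP => exact inferInstanceAs (Finite (Option (Σ i, (P i).Lab)))
  | loop f P hP => exact inferInstanceAs (Finite (Option P.Lab))

variable [DecidableEq K]

/-- `Runs P st st' t`: started in the state `st`, the program `P` terminates in the state `st'` after
at most `t` steps. -/
inductive Runs : Prog K σ A ι → σ × (K → List A) → σ × (K → List A) → ℕ → Prop
  | load (f : σ → σ) (s : σ) (S : K → List A) (t : ℕ) (ht : 1 ≤ t) :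
      Runs (.load f) (s, S) (f s, S) t
  | push (k : K) (f : σ → A) (s : σ) (S : K → List A) (t : ℕ) (ht : 1 ≤ t) :
      Runs (.push k f) (s, S) (s, Function.update S k (f s :: S k)) t
  | pop (k : K) (f : σ → Option A → σ) (s : σ) (S : K → List A) (t : ℕ) (ht : 1 ≤ t) :
      Runs (.pop k f) (s, S) (f s (S k).head?, Function.update S k (S k).tail) t
  | seq {P Q : Prog K σ A ι} {a b c : σ × (K → List A)} {t₁ t₂ t : ℕ}
      (hP : Runs P a b t₁) (hQ : Runs Q b c t₂) (ht : t₁ + t₂ ≤ t) : Runs (.seq P Q) a c t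
  | ite_true {f : σ → Bool} {P Q : Prog K σ A ι} {a b : σ × (K → List A)} {t₁ t : ℕ}
      (hf : f a.1 = true) (hP : Runs P a b t₁) (ht : t₁ + 1 ≤ t) : Runs (.ite f P Q) a b t
  | ite_false {f : σ → Bool} {P Q : Prog K σ A ι} {a b : σ × (K → List A)} {t₁ t : ℕ}
      (hf : f a.1 = false) (hQ : Runs Q a b t₁) (ht : t₁ + 1 ≤ t) : Runs (.ite f P Q) a b t
  | case {f : σ → ι} {P : ι → Prog K σ A ι} {a b : σ × (K → List A)} {t₁ t : ℕ}
      (hP : Runs (P (f a.1)) a b t₁) (ht : t₁ + 1 ≤ t) : Runs (.case f P) a b t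
  | loop_false {f : σ → Bool} {P : Prog K σ A ι} {a : σ × (K → List A)} {t : ℕ}
      (hf : f a.1 = false) (ht : 1 ≤ t) : Runs (.loop f P) a a t
  | loop_true {f : σ → Bool} {P : Prog K σ A ι} {a b c : σ × (K → List A)} {t₁ t₂ t : ℕ}
      (hf : f a.1 = true) (hP : Runs P a b t₁) (hL : Runs (.loop f P) b c t₂)
      (ht : t₁ + t₂ + 1 ≤ t) : Runs (.loop f P) a c t

theorem Runs.mono {P : Prog K σ A ι} {a b : σ × (K → List A)} {t t' : ℕ} (h : Runs P a b t)
    (ht' : t ≤ t') : Runs P a b t' := by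
  cases h with
  | load f s S _ ht => exact .load f s S _ (ht.trans ht')
  | push k f s S _ ht => exact .push k f s S _ (ht.trans ht')
  | pop k f s S _ ht => exact .pop k f s S _ (ht.trans ht')
  | seq hP hQ ht => exact .seq hP hQ (ht.trans ht')
  | ite_true hf hP ht => exact .ite_true hf hP (ht.trans ht')
  | ite_false hf hP ht => exact .ite_false hf hP (ht.trans ht')
  | case hP ht => exact .case hP (ht.trans ht')
  | loop_false hf ht => exact .loop_false hf (ht.trans ht')
  | loop_true hf hP hL ht => exact .loop_true hf hP hL (ht.trans ht')

/-- The stacks grow by at most one symbol per step. -/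
theorem Runs.length_le {P : Prog K σ A ι} {a b : σ × (K → List A)} {t : ℕ} (h : Runs P a b t)
    (k : K) : (b.2 k).length ≤ (a.2 k).length + t := by
  induction h with
  | load f s S t ht => simp
  | push k' f s S t ht =>
    by_cases hk : k = k'
    · subst hk; simp; omega
    · simp [Function.update_of_ne hk]
  | pop k' f s S t ht =>
    by_cases hk : k = k'
    · subst hk; simp; omega
    · simp [Function.update_of_ne hk]
  | loop_false => simp
  | _ => omega

/-- A loop-free program. -/
def Straight : Prog K σ A ι → Prop
  | .load _ => True
  | .push _ _ => True
  | .pop _ _ => True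
  | .seq P Q => P.Straight ∧ Q.Straight
  | .ite _ P Q => P.Straight ∧ Q.Straight
  | .case _ _ => False
  | .loop _ _ => False

/-- The effect of a loop-free program. On the remaining constructs the value is irrelevant. -/
def exec : Prog K σ A ι → σ × (K → List A) → σ × (K → List A)
  | .load f, a => (f a.1, a.2)
  | .push k f, a => (a.1, Function.update a.2 k (f a.1 :: a.2 k))
  | .pop k f, a => (f a.1 (a.2 k).head?, Function.update a.2 k (a.2 k).tail)
  | .seq P Q, a => Q.exec (P.exec a)
  | .ite f P Q, a => if f a.1 then P.exec a else Q.exec a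
  | .case _ _, a => a
  | .loop _ _, a => a

/-- A bound on the running time of a loop-free program. -/
def cost : Prog K σ A ι → ℕ
  | .load _ => 1
  | .push _ _ => 1
  | .pop _ _ => 1
  | .seq P Q => P.cost + Q.cost
  | .ite _ P Q => P.cost + Q.cost + 1
  | .case _ _ => 0
  | .loop _ _ => 0

theorem Straight.runs {P : Prog K σ A ι} (h : P.Straight) (a : σ × (K → List A)) :
    Runs P a (P.exec a) P.cost := by
  induction P generalizing a with
  | load f => exact .load f _ _ _ le_rfl
  | push k f => exact .push k f _ _ _ le_rfl
  | pop k f => exact .pop k f _ _ _ le_rfl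
  | seq P Q ihP ihQ => exact .seq (ihP h.1 a) (ihQ h.2 _) le_rfl
  | ite f P Q ihP ihQ =>
    cases hf : f a.1
    · simpa [exec, cost, hf] using Runs.ite_false (P := P) hf (ihQ h.2 a) (t := P.cost + Q.cost + 1)
        (by omega)
    · simpa [exec, cost, hf] using Runs.ite_true (Q := Q) hf (ihP h.1 a) (t := P.cost + Q.cost + 1)
        (by omega)
  | case f P => exact h.elim
  | loop f P => exact h.elim

theorem Straight.runs' {P : Prog K σ A ι} (h : P.Straight) {a b : σ × (K → List A)} {t : ℕ}
    (hb : P.exec a = b) (ht : P.cost ≤ t) : Runs P a b t :=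
  hb ▸ (h.runs a).mono ht

/-! ### Compilation to Turing machines with several stacks -/

/-- The label at which the execution starts. -/
def entry : (P : Prog K σ A ι) → P.Lab
  | .load _ => ()
  | .push _ _ => ()
  | .pop _ _ => ()
  | .seq P _ => Sum.inl P.entry
  | .ite _ _ _ => none
  | .case _ _ => none
  | .loop _ _ => none

/-- The stack alphabets of the compiled machine: the stack `none` receives the answer, the other ones
are the stacks of the program. All of them are finite when `A` is, although Mathlib requires this of
the input stack only. -/
abbrev Alph (K A : Type) : Option K → Type
  | none => Bool
  | some _ => A

/-- The statement at a label of a program that is embedded by `emb` into a machine, and continues at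
the label `exit`. The control state of the machine has an additional flag. -/
def compile {Λ : Type} : (P : Prog K σ A ι) → (P.Lab → Λ) → Λ → P.Lab →
    Turing.TM2.Stmt (Alph K A) Λ (σ × Bool)
  | .load f, _, exit, _ => .load (fun v => (f v.1, v.2)) (.goto fun _ => exit)
  | .push k f, _, exit, _ => .push (some k) (fun v => f v.1) (.goto fun _ => exit)
  | .pop k f, _, exit, _ => .pop (some k) (fun v a => (f v.1 a, v.2)) (.goto fun _ => exit)
  | .seq P Q, emb, _, .inl l => P.compile (emb ∘ .inl) (emb (.inr Q.entry)) l
  | .seq _ Q, emb, exit, .inr l => Q.compile (emb ∘ .inr) exit l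
  | .ite f P Q, emb, _, none =>
      .goto fun v => if f v.1 then emb (some (.inl P.entry)) else emb (some (.inr Q.entry))
  | .ite _ P _, emb, exit, some (.inl l) => P.compile (emb ∘ some ∘ .inl) exit l
  | .ite _ _ Q, emb, exit, some (.inr l) => Q.compile (emb ∘ some ∘ .inr) exit l
  | .case f P, emb, _, none => .goto fun v => emb (some ⟨f v.1, (P (f v.1)).entry⟩)
  | .case _ P, emb, exit, some ⟨i, l⟩ => (P i).compile (fun l => emb (some ⟨i, l⟩)) exit l
  | .loop f P, emb, exit, none => .goto fun v => if f v.1 then emb (some P.entry) else exit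
  | .loop _ P, emb, _, some l => P.compile (emb ∘ some) (emb none) l

/-- The stacks of the machine when the answer stack is empty. -/
def fullStacks (S : K → List A) : (k : Option K) → List (Alph K A k)
  | none => []
  | some k => S k

theorem update_fullStacks (S : K → List A) (k : K) (l : List A) :
    Function.update (fullStacks S) (some k) l = fullStacks (Function.update S k l) := by
  funext k'
  cases k' with
  | none => rfl
  | some k' =>
    by_cases h : k' = k
    · subst h
      exact (Function.update_self (some k') l (fullStacks S)).trans
        (Function.update_self k' l S).symm
    · exact (Function.update_of_ne (by simpa using h) _ _).trans
        (Function.update_of_ne (β := fun _ => List A) h l S).symm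

/-- `n` steps of a machine. -/
def steps {Λ : Type} (M : Λ → Turing.TM2.Stmt (Alph K A) Λ (σ × Bool)) (n : ℕ)
    (c : Turing.TM2.Cfg (Alph K A) Λ (σ × Bool)) :
    Option (Turing.TM2.Cfg (Alph K A) Λ (σ × Bool)) :=
  (flip bind (Turing.TM2.step M))^[n] (some c)

theorem steps_one {Λ : Type} {M : Λ → Turing.TM2.Stmt (Alph K A) Λ (σ × Bool)} {l : Λ}
    {q : Turing.TM2.Stmt (Alph K A) Λ (σ × Bool)} (h : M l = q) (v : σ × Bool)
    (S : (k : Option K) → List (Alph K A k)) :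
    steps M 1 ⟨some l, v, S⟩ = some (Turing.TM2.stepAux q v S) := h ▸ rfl

theorem steps_add {Λ : Type} {M : Λ → Turing.TM2.Stmt (Alph K A) Λ (σ × Bool)} {m n : ℕ}
    {c c' : Turing.TM2.Cfg (Alph K A) Λ (σ × Bool)} (h : steps M m c = some c') :
    steps M (n + m) c = steps M n c' := by
  unfold steps at *
  rw [Function.iterate_add_apply, h]

/-- Compilation is correct and preserves the running time. -/
theorem Runs.steps {P : Prog K σ A ι} {a b : σ × (K → List A)} {t : ℕ} (h : Runs P a b t)
    {Λ : Type} (M : Λ → Turing.TM2.Stmt (Alph K A) Λ (σ × Bool)) (emb : P.Lab → Λ) (exit : Λ)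
    (hM : ∀ l, M (emb l) = P.compile emb exit l) (x : Bool) :
    ∃ n ≤ t, Prog.steps M n ⟨some (emb P.entry), (a.1, x), fullStacks a.2⟩ =
      some ⟨some exit, (b.1, x), fullStacks b.2⟩ := by
  induction h generalizing exit with
  | load f s S t ht => exact ⟨1, ht, (steps_one (hM _) _ _).trans rfl⟩
  | push k f s S t ht =>
    refine ⟨1, ht, ?_⟩
    refine (steps_one (hM _) _ _).trans ?_
    simp only [compile, Turing.TM2.stepAux]
    exact congrArg (fun S' => some (Turing.TM2.Cfg.mk (some exit) (s, x) S')) (update_fullStacks S k _)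
  | pop k f s S t ht =>
    refine ⟨1, ht, ?_⟩
    refine (steps_one (hM _) _ _).trans ?_
    simp only [compile, Turing.TM2.stepAux]
    exact congrArg (fun S' => some (Turing.TM2.Cfg.mk (some exit) (f s (S k).head?, x) S'))
      (update_fullStacks S k _)
  | @seq P Q a b c t₁ t₂ t hP hQ ht ihP ihQ =>
    obtain ⟨n₁, hn₁, e₁⟩ := ihP (emb ∘ .inl) (emb (.inr Q.entry)) fun l => hM (.inl l)
    obtain ⟨n₂, hn₂, e₂⟩ := ihQ (emb ∘ .inr) exit fun l => hM (.inr l)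
    exact ⟨n₂ + n₁, by omega, (steps_add e₁).trans e₂⟩
  | @ite_true f P Q a b t₁ t hf hP ht ihP =>
    obtain ⟨n₁, hn₁, e₁⟩ := ihP (emb ∘ some ∘ .inl) exit fun l => hM (some (.inl l))
    refine ⟨n₁ + 1, by omega, (steps_add ?_).trans e₁⟩
    exact (steps_one (hM none) _ _).trans (by simp [compile, Turing.TM2.stepAux, hf]; try rfl)
  | @ite_false f P Q a b t₁ t hf hP ht ihP =>
    obtain ⟨n₁, hn₁, e₁⟩ := ihP (emb ∘ some ∘ .inr) exit fun l => hM (some (.inr l))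
    refine ⟨n₁ + 1, by omega, (steps_add ?_).trans e₁⟩
    exact (steps_one (hM none) _ _).trans (by simp [compile, Turing.TM2.stepAux, hf]; try rfl)
  | @case f P a b t₁ t hP ht ihP =>
    obtain ⟨n₁, hn₁, e₁⟩ := ihP (fun l => emb (some ⟨f a.1, l⟩)) exit fun l => hM (some ⟨_, l⟩)
    refine ⟨n₁ + 1, by omega, (steps_add ?_).trans e₁⟩
    exact (steps_one (hM none) _ _).trans (by simp [compile, Turing.TM2.stepAux])
  | @loop_false f P a t hf ht =>
    refine ⟨1, ht, ?_⟩
    exact (steps_one (hM none) _ _).trans (by simp [compile, Turing.TM2.stepAux, hf]; try rfl)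
  | @loop_true f P a b c t₁ t₂ t hf hP hL ht ihP ihL =>
    obtain ⟨n₁, hn₁, e₁⟩ := ihP (emb ∘ some) (emb none) fun l => hM (some l)
    obtain ⟨n₂, hn₂, e₂⟩ := ihL emb exit hM
    refine ⟨n₂ + (n₁ + 1), by omega, (steps_add ((steps_add ?_).trans e₁)).trans e₂⟩
    exact (steps_one (hM none) _ _).trans (by simp [compile, Turing.TM2.stepAux, hf]; try rfl)

/-- The last phase of the machine, at the label `self`: it pops one symbol from each stack and
repeats, unless all stacks were empty; in that case it writes the answer and halts. -/
def clearStmt {Λ : Type} (self : Λ) (s₀ : σ) (out : σ → Bool) :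
    List K → Turing.TM2.Stmt (Alph K A) Λ (σ × Bool)
  | [] => .branch (fun v => v.2) (.load (fun v => (v.1, false)) (.goto fun _ => self))
      (.push none (fun v => out v.1) (.load (fun _ => (s₀, false)) .halt))
  | k :: ks => .pop (some k) (fun v a => (v.1, v.2 || a.isSome)) (clearStmt self s₀ out ks)

theorem stepAux_clearStmt {Λ : Type} (self : Λ) (s₀ : σ) (out : σ → Bool) (ks : List K)
    (hks : ks.Nodup) (v : σ × Bool) (S : K → List A) :
    Turing.TM2.stepAux (clearStmt self s₀ out ks) v (fullStacks S) =
      Turing.TM2.stepAux (clearStmt self s₀ out []) (v.1, v.2 || ks.any fun k => !(S k).isEmpty)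
        (fullStacks fun k => if k ∈ ks then (S k).tail else S k) := by
  induction ks generalizing v S with
  | nil => simp
  | cons k ks ih =>
    rw [List.nodup_cons] at hks
    rw [show clearStmt self s₀ out (k :: ks) = .pop (some k) (fun v a => (v.1, v.2 || a.isSome))
      (clearStmt self s₀ out ks) from rfl, Turing.TM2.stepAux]
    have hu := update_fullStacks S k (S k).tail
    change Turing.TM2.stepAux (clearStmt self s₀ out ks) _
      (Function.update (fullStacks S) (some k) (S k).tail) = _
    rw [hu, ih hks.2]
    congr 1
    · have h1 : (ks.any fun k' => !(Function.update S k (S k).tail k').isEmpty) =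
          ks.any fun k' => !(S k').isEmpty := by
        rw [Bool.eq_iff_iff]
        simp only [List.any_eq_true]
        refine exists_congr fun k' => and_congr_right fun hk' => ?_
        rw [Function.update_of_ne (by rintro rfl; exact hks.1 hk')]
      have h2 : (fullStacks S (some k)).head?.isSome = !(S k).isEmpty := by
        change (S k).head?.isSome = _
        cases S k <;> rfl
      simp only [h1, h2, List.any_cons, Bool.or_assoc]
    · congr 1
      funext k'
      by_cases h : k' = k
      · subst h; simp [hks.1]
      · simp [h]

/-- The last phase empties the stacks and writes the answer. If they have at most `m` symbols each, it
takes `m` rounds, and one more to find all of them empty. -/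
theorem clear_steps {Λ : Type} [Fintype K] (M : Λ → Turing.TM2.Stmt (Alph K A) Λ (σ × Bool))
    (self : Λ) (s₀ : σ) (out : σ → Bool)
    (hM : M self = clearStmt self s₀ out Finset.univ.toList) (m : ℕ) (s : σ) (S : K → List A)
    (hS : ∀ k, (S k).length ≤ m) :
    ∃ n ≤ m + 1, Prog.steps M n ⟨some self, (s, false), fullStacks S⟩ =
      some ⟨none, (s₀, false), Function.update (fullStacks fun _ => []) none [out s]⟩ := by
  induction m generalizing S with
  | zero =>
    have hS' : S = fun _ => [] := funext fun k => List.length_eq_zero_iff.mp (Nat.le_zero.mp (hS k))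
    subst hS'
    refine ⟨1, le_rfl, ?_⟩
    rw [steps_one hM, stepAux_clearStmt _ _ _ _ (Finset.nodup_toList _)]
    have h : ((Finset.univ : Finset K).toList.any fun _ => false) = false := by
      simp [List.any_eq_false]
    simp [clearStmt, h]
    rfl
  | succ m ih =>
    by_cases h : ∀ k, S k = []
    · have hS' : S = fun _ => [] := funext h
      obtain ⟨n, hn, e⟩ := ih S fun k => by simp [h k]
      exact ⟨n, by omega, e⟩
    · push Not at h
      obtain ⟨k, hk⟩ := h
      obtain ⟨n, hn, e⟩ := ih (fun k => (S k).tail) fun k => by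
        have := hS k
        simp only [List.length_tail]; omega
      refine ⟨n + 1, by omega, (steps_add ?_).trans e⟩
      rw [steps_one hM, stepAux_clearStmt _ _ _ _ (Finset.nodup_toList _)]
      have hany : ((Finset.univ : Finset K).toList.any fun k => !(S k).isEmpty) = true := by
        simp only [List.any_eq_true]
        exact ⟨k, by simp, by simpa using hk⟩
      rw [hany]
      simp [clearStmt]

/-- The machine of a program: it runs the program from the control state `s₀` and then answers
`out`. -/
noncomputable def machine [Fintype K] [Fintype A] [Finite ι] [Finite σ] (P : Prog K σ A ι) (k₀ : K)
    (s₀ : σ) (out : σ → Bool) : Turing.FinTM2 :=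
  have := P.finite_lab
  { K := Option K
    k₀ := some k₀
    k₁ := none
    Γ := Alph K A
    Λ := Option P.Lab
    main := some P.entry
    ΛFin := Fintype.ofFinite _
    σ := σ × Bool
    initialState := (s₀, false)
    σFin := Fintype.ofFinite _
    Γk₀Fin := inferInstanceAs (Fintype A)
    m := fun l => match l with
      | none => clearStmt none s₀ out Finset.univ.toList
      | some l => P.compile some none l }

/-- A program that decides a predicate within polynomially many steps yields a Turing machine that
decides it in polynomial time. -/
theorem computableInPolyTime [Finite K] [Fintype A] [Finite ι] [Finite σ] {X : Type}
    (enc : X → List A) (f : X → Bool) (P : Prog K σ A ι) (k₀ : K) (s₀ : σ) (out : σ → Bool)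
    (c d : ℕ)
    (h : ∀ x, ∃ st, Runs P (s₀, Function.update (fun _ => []) k₀ (enc x)) st
      (c * ((enc x).length + 1) ^ d) ∧ out st.1 = f x) :
    Nonempty (Turing.TM2ComputableInPolyTime enc Computability.encodeBool f) := by
  have := Fintype.ofFinite K
  -- The program runs for at most `c * (n + 1) ^ d` steps. This also bounds the growth of the stacks,
  -- hence the number of rounds of the last phase.
  refine ⟨{
    tm := machine P k₀ s₀ out
    inputAlphabet := Equiv.refl A
    outputAlphabet := Equiv.refl Bool
    time := 2 * (Polynomial.C c * (Polynomial.X + 1) ^ d) + Polynomial.X + 1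
    outputsFun := fun x => Classical.choice ?_ }⟩
  obtain ⟨⟨s, S⟩, hP, hout⟩ := h x
  set T := c * ((enc x).length + 1) ^ d with hT
  obtain ⟨n₁, hn₁, e₁⟩ := hP.steps (Λ := Option P.Lab) (machine P k₀ s₀ out).m some none
    (fun _ => rfl) false
  have hlen : ∀ k, (S k).length ≤ (enc x).length + T := fun k => by
    have h1 := hP.length_le k
    by_cases hk : k = k₀
    · subst hk; simpa using h1
    · simp only [Function.update_of_ne hk, List.length_nil] at h1; omega
  obtain ⟨n₂, hn₂, e₂⟩ := clear_steps (Λ := Option P.Lab) (machine P k₀ s₀ out).m none s₀ out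
    rfl ((enc x).length + T) s S hlen
  refine ⟨⟨⟨n₂ + n₁, ?_⟩, ?_⟩⟩
  · have e := (steps_add e₁).trans e₂
    have h0 : (fun _ => [] : (k : Option K) → List (Alph K A k)) = fullStacks fun _ => [] :=
      funext fun k => by cases k <;> rfl
    rw [Turing.initList_eq, Option.map_some, Turing.haltList_eq]
    refine Eq.trans (congrArg (steps (machine P k₀ s₀ out).m (n₂ + n₁)) ?_) (e.trans ?_)
    · refine congrArg (Turing.TM2.Cfg.mk _ _) (Eq.trans ?_ (update_fullStacks _ k₀ (enc x)))
      exact (congrArg (fun l => Function.update (fun _ => [] : (k : Option K) → List (Alph K A k))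
        (some k₀) l) (List.map_id _)).trans (congrArg (fun g => Function.update g (some k₀) (enc x)) h0)
    · refine congrArg (fun S => some (Turing.TM2.Cfg.mk none (s₀, false) S)) ?_
      rw [← h0, show out s = f x from hout]
      rfl
  · simp only [Polynomial.eval_add, Polynomial.eval_mul, Polynomial.eval_C, Polynomial.eval_X,
      Polynomial.eval_pow, Polynomial.eval_one, Polynomial.eval_ofNat]
    omega

end Prog

/-! ### Families of sets given by semilinear conditions on type counts -/

section TypeCount

variable {E T : Type} {ty : E → T} {U : Set E}

/-- The number of elements of each type in a set. -/
noncomputable def typeCount (ty : E → T) (X : Set E) : T → ℕ :=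
  fun τ => (X ∩ ty ⁻¹' {τ}).ncard

@[simp] theorem typeCount_empty : typeCount ty ∅ = 0 := by
  funext τ; simp [typeCount]

theorem typeCount_union {X Y : Set E} (hX : X.Finite) (hY : Y.Finite) (h : Disjoint X Y) :
    typeCount ty (X ∪ Y) = typeCount ty X + typeCount ty Y := by
  funext τ
  simp only [typeCount, Pi.add_apply, Set.union_inter_distrib_right]
  exact Set.ncard_union_eq (h.mono Set.inter_subset_left Set.inter_subset_left)
    (hX.subset Set.inter_subset_left) (hY.subset Set.inter_subset_left)

open Classical in
theorem typeCount_singleton (x : E) : typeCount ty {x} = Pi.single (ty x) 1 := by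
  funext τ
  by_cases h : τ = ty x
  · subst h
    have : ({x} ∩ ty ⁻¹' {ty x} : Set E) = {x} := by ext y; simp +contextual
    simp [typeCount, this]
  · have : ({x} ∩ ty ⁻¹' {τ} : Set E) = ∅ := by
      ext y
      simp only [Set.mem_inter_iff, Set.mem_singleton_iff, Set.mem_preimage, Set.mem_empty_iff_false,
        iff_false, not_and]
      rintro rfl h'
      exact h h'.symm
    simp [typeCount, this, h]

/-- A set whose count is a sum can be split accordingly. -/
theorem exists_split_of_typeCount_eq_add {X : Set E} (hX : X.Finite) {a b : T → ℕ}
    (h : typeCount ty X = a + b) :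
    ∃ Y Z, Disjoint Y Z ∧ X = Y ∪ Z ∧ typeCount ty Y = a ∧ typeCount ty Z = b := by
  have hle : ∀ τ, a τ ≤ (X ∩ ty ⁻¹' {τ}).ncard := fun τ => by
    have := congrFun h τ
    simp only [typeCount, Pi.add_apply] at this
    omega
  -- Choose `a τ` elements of each type `τ`.
  choose A hA hAcard using fun τ => Set.exists_subset_card_eq (hle τ)
  have hYX : (⋃ τ, A τ) ⊆ X := Set.iUnion_subset fun τ => (hA τ).trans Set.inter_subset_left
  have hY : typeCount ty (⋃ τ, A τ) = a := by
    funext τ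
    rw [← hAcard τ, typeCount]
    congr 1
    ext x
    simp only [Set.mem_inter_iff, Set.mem_iUnion, Set.mem_preimage, Set.mem_singleton_iff]
    constructor
    · rintro ⟨⟨σ, hx⟩, rfl⟩
      have : ty x = σ := (hA σ hx).2
      rwa [this]
    · exact fun hx => ⟨⟨τ, hx⟩, (hA τ hx).2⟩
  refine ⟨⋃ τ, A τ, X \ ⋃ τ, A τ, Set.disjoint_sdiff_right, (Set.union_sdiff_cancel hYX).symm,
    hY, ?_⟩
  have h2 := typeCount_union (ty := ty) (hX.subset hYX) (hX.subset Set.sdiff_subset)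
    (Set.disjoint_sdiff_right (s := ⋃ τ, A τ) (t := X))
  rw [Set.union_sdiff_cancel hYX, h, hY] at h2
  exact (add_left_cancel h2).symm

/-- The family `𝓐` consists of the subsets of `U` whose type count lies in `S`. -/
def CountedBy (ty : E → T) (U : Set E) (𝓐 : Set (Set E)) (S : Set (T → ℕ)) : Prop :=
  ∀ X, X ∈ 𝓐 ↔ X ⊆ U ∧ typeCount ty X ∈ S

theorem CountedBy.union {𝓐 𝓑 : Set (Set E)} {S S' : Set (T → ℕ)} (hA : CountedBy ty U 𝓐 S)
    (hB : CountedBy ty U 𝓑 S') : CountedBy ty U (𝓐 ∪ 𝓑) (S ∪ S') := fun X => by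
  rw [Set.mem_union, Set.mem_union, hA, hB]
  tauto

open Pointwise in
theorem CountedBy.disjointUnions {𝓐 𝓑 : Set (Set E)} {S S' : Set (T → ℕ)} (hU : U.Finite)
    (hA : CountedBy ty U 𝓐 S) (hB : CountedBy ty U 𝓑 S') :
    CountedBy ty U (ShEx.disjointUnions 𝓐 𝓑) (S + S') := fun X => by
  constructor
  · rintro ⟨Y, hY, Z, hZ, hd, rfl⟩
    rw [hA] at hY
    rw [hB] at hZ
    refine ⟨Set.union_subset hY.1 hZ.1, ?_⟩
    rw [typeCount_union (hU.subset hY.1) (hU.subset hZ.1) hd]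
    exact Set.add_mem_add hY.2 hZ.2
  · rintro ⟨hX, a, ha, b, hb, hab⟩
    obtain ⟨Y, Z, hd, rfl, hY, hZ⟩ := exists_split_of_typeCount_eq_add (hU.subset hX) hab.symm
    exact ⟨Y, (hA Y).2 ⟨Set.subset_union_left.trans hX, hY ▸ ha⟩, Z,
      (hB Z).2 ⟨Set.subset_union_right.trans hX, hZ ▸ hb⟩, hd, rfl⟩

/-- Unions of pairwise disjoint members correspond to sums of their type counts, hence to the elements
of the submonoid that the counts generate. -/
theorem CountedBy.disjointStar {𝓐 : Set (Set E)} {S : Set (T → ℕ)} (hU : U.Finite)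
    (hA : CountedBy ty U 𝓐 S) :
    CountedBy ty U (ShEx.disjointStar 𝓐) (AddSubmonoid.closure S : Set (T → ℕ)) := fun X => by
  have hcons : ∀ (F : Set E) (l : List (Set E)),
      ⋃₀ {G | G ∈ F :: l} = F ∪ ⋃₀ {G | G ∈ l} := fun F l => by
    ext x; simp
  constructor
  · rintro ⟨l, hl, hd, rfl⟩
    induction l with
    | nil => simp
    | cons F l ih =>
      rw [List.pairwise_cons] at hd
      obtain ⟨h1, h2⟩ := ih (fun G hG => hl G (List.mem_cons_of_mem _ hG)) hd.2
      obtain ⟨h3, h4⟩ := (hA F).1 (hl F List.mem_cons_self)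
      rw [hcons]
      refine ⟨Set.union_subset h3 h1, ?_⟩
      rw [typeCount_union (hU.subset h3) (hU.subset h1)
        (Set.disjoint_sUnion_right.2 fun G hG => hd.1 G hG)]
      exact add_mem (AddSubmonoid.subset_closure h4) h2
  · rintro ⟨hX, hS⟩
    generalize hv : typeCount ty X = v at hS
    induction hS using AddSubmonoid.closure_induction_left generalizing X with
    | zero =>
      have hX0 : X = ∅ := by
        by_contra hne
        obtain ⟨x, hx⟩ := Set.nonempty_iff_ne_empty.2 hne
        have := congrFun hv (ty x)
        simp only [typeCount, Pi.zero_apply] at this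
        rw [Set.ncard_eq_zero ((hU.subset hX).subset Set.inter_subset_left)] at this
        exact (this ▸ (⟨hx, rfl⟩ : x ∈ X ∩ ty ⁻¹' {ty x}) : x ∈ (∅ : Set E))
      subst hX0
      exact ⟨[], by simp, List.Pairwise.nil, by simp⟩
    | add_left a ha b _ ih =>
      obtain ⟨Y, Z, hd, rfl, hY, hZ⟩ := exists_split_of_typeCount_eq_add (hU.subset hX) hv
      obtain ⟨l, hl, hld, rfl⟩ := ih Z (Set.subset_union_right.trans hX) hZ
      refine ⟨Y :: l, ?_, List.pairwise_cons.2 ⟨fun G hG => ?_, hld⟩, (hcons Y l).symm⟩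
      · intro F hF
        rcases List.mem_cons.1 hF with rfl | hF
        · exact (hA F).2 ⟨Set.subset_union_left.trans hX, hY ▸ ha⟩
        · exact hl F hF
      · exact hd.mono_right (Set.subset_sUnion_of_mem hG)

open Classical in
/-- The unit vectors at the types that satisfy `P`. -/
def unitCounts (P : T → Prop) : Set (T → ℕ) :=
  {v | ∃ τ, P τ ∧ v = Pi.single τ 1}

open Classical in
theorem countedBy_singletons (hU : U.Finite) (P : T → Prop) :
    CountedBy ty U {X | ∃ x ∈ U, P (ty x) ∧ X = {x}} (unitCounts P) :=
    fun X => by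
  constructor
  · rintro ⟨x, hx, hP, rfl⟩
    exact ⟨by simpa using hx, ty x, hP, typeCount_singleton x⟩
  · rintro ⟨hX, τ, hP, hv⟩
    have h1 : (X ∩ ty ⁻¹' {τ}).ncard = 1 := by
      have := congrFun hv τ
      simpa [typeCount] using this
    obtain ⟨x, hx⟩ := Set.ncard_eq_one.1 h1
    have hxm : x ∈ X ∩ ty ⁻¹' {τ} := hx ▸ rfl
    have hxτ : ty x = τ := hxm.2
    refine ⟨x, hX hxm.1, hxτ ▸ hP, Set.eq_singleton_iff_unique_mem.2 ⟨hxm.1, fun y hy => ?_⟩⟩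
    have hy' : ty y = τ := by
      by_contra hne
      have := congrFun hv (ty y)
      rw [Pi.single_eq_of_ne hne, typeCount,
        Set.ncard_eq_zero ((hU.subset hX).subset Set.inter_subset_left)] at this
      exact (this ▸ (⟨hy, rfl⟩ : y ∈ X ∩ ty ⁻¹' {ty y}) : y ∈ (∅ : Set E))
    exact hx.subset ⟨hy, hy'⟩

theorem countedBy_subsets (hU : U.Finite) (P : T → Prop) :
    CountedBy ty U {X | ∀ x ∈ X, x ∈ U ∧ P (ty x)} {v | ∀ τ, ¬ P τ → v τ = 0} := fun X => by
  constructor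
  · refine fun h => ⟨fun x hx => (h x hx).1, fun τ hτ => ?_⟩
    have : X ∩ ty ⁻¹' {τ} = ∅ := by
      ext x
      simp only [Set.mem_inter_iff, Set.mem_preimage, Set.mem_singleton_iff,
        Set.mem_empty_iff_false, iff_false, not_and]
      rintro hx rfl
      exact hτ (h x hx).2
    simp [typeCount, this]
  · rintro ⟨hX, hv⟩ x hx
    refine ⟨hX hx, ?_⟩
    by_contra hP
    have := hv _ hP
    rw [typeCount, Set.ncard_eq_zero ((hU.subset hX).subset Set.inter_subset_left)] at this
    exact (this ▸ (⟨hx, rfl⟩ : x ∈ X ∩ ty ⁻¹' {ty x}) : x ∈ (∅ : Set E))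

theorem countedBy_singleton_empty (hU : U.Finite) : CountedBy ty U {∅} {0} := fun X => by
  constructor
  · rintro rfl
    simp
  · rintro ⟨hX, hv⟩
    by_contra hne
    obtain ⟨x, hx⟩ := Set.nonempty_iff_ne_empty.2 hne
    have := congrFun hv (ty x)
    simp only [typeCount, Pi.zero_apply] at this
    rw [Set.ncard_eq_zero ((hU.subset hX).subset Set.inter_subset_left)] at this
    exact (this ▸ (⟨hx, rfl⟩ : x ∈ X ∩ ty ⁻¹' {ty x}) : x ∈ (∅ : Set E))

/-- The vectors that vanish outside `P` are the kernel of a restriction map. -/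
theorem isSemilinearSet_vanishing [Finite T] (P : T → Prop) :
    IsSemilinearSet {v : T → ℕ | ∀ τ, ¬ P τ → v τ = 0} := by
  have := Fintype.ofFinite T
  let f : (T → ℕ) →+ ({τ // ¬ P τ} → ℕ) :=
    { toFun := fun v τ => v τ.1
      map_zero' := rfl
      map_add' := fun _ _ => rfl }
  have h := (IsSemilinearSet.singleton (0 : {τ // ¬ P τ} → ℕ)).preimage f
  convert h using 1
  ext v
  simp [f, funext_iff]

open Classical in
theorem isSemilinearSet_unitCounts [Finite T] (P : T → Prop) : IsSemilinearSet (unitCounts P) :=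
  .of_finite ((Set.toFinite (Set.range fun τ : T => (Pi.single τ 1 : T → ℕ))).subset (by
    rintro _ ⟨τ, _, rfl⟩
    exact ⟨τ, rfl⟩))

end TypeCount

/-! ### Triple expressions as semilinear sets -/

namespace ShEx

variable {I L B V N : Type} {P' L' : Type}

/-- The type of an edge: whether it is an edge or the inverse of one, the class of its predicate, and
the label of its target. -/
def Edge.type (cls : I → P') (lab : Term I L B → L') (x : Edge I L B) : Bool × P' × L' :=
  match x.dir with
  | .fwd p => (true, cls p, lab x.tgt)
  | .inv p => (false, cls p, lab x.tgt)

/-- The predicates of the edges that occur in a closed triple expression. -/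
def ClosedExpr.preds : ClosedExpr I L V N → Set I
  | .eps => ∅
  | .edge p _ => {p}
  | .invEdge p _ => {p}
  | .seq f g => f.preds ∪ g.preds
  | .alt f g => f.preds ∪ g.preds
  | .star f => f.preds

/-- The predicates that occur in a triple expression, its forbidden ones included. -/
def TripleExpr.preds : TripleExpr I L V N → Set I
  | .invOpen f R => f.preds ∪ R
  | .open_ f R Q => f.preds ∪ R ∪ Q

/-- Whether the targets with a given label satisfy a shape, if that shape is a name. Other shapes do
not occur in shallow expressions, and the value for them is irrelevant. -/
def Shape.labelSat (mem : N → L' → Prop) : Shape I L V N → L' → Prop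
  | .name s, l => mem s l
  | _, _ => False

open Pointwise in
/-- The type counts of the sets that match a shallow closed triple expression. -/
def ClosedExpr.counts (cls : I → P') (mem : N → L' → Prop) :
    ClosedExpr I L V N → Set (Bool × P' × L' → ℕ)
  | .eps => {0}
  | .edge p φ => unitCounts fun τ => τ.1 = true ∧ τ.2.1 = cls p ∧ φ.labelSat mem τ.2.2
  | .invEdge p φ => unitCounts fun τ => τ.1 = false ∧ τ.2.1 = cls p ∧ φ.labelSat mem τ.2.2
  | .seq f g => f.counts cls mem + g.counts cls mem
  | .alt f g => f.counts cls mem ∪ g.counts cls mem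
  | .star f => AddSubmonoid.closure (f.counts cls mem)

open Pointwise in
/-- The type counts of the sets that match a shallow triple expression. -/
def TripleExpr.counts (cls : I → P') (mem : N → L' → Prop) :
    TripleExpr I L V N → Set (Bool × P' × L' → ℕ)
  | .invOpen f R =>
      f.counts cls mem + {v | ∀ τ, ¬ (τ.1 = false ∧ ∀ p ∈ R, τ.2.1 ≠ cls p) → v τ = 0}
  | .open_ f R Q =>
      f.counts cls mem + {v | ∀ τ, ¬ (τ.1 = false ∧ ∀ p ∈ R, τ.2.1 ≠ cls p) → v τ = 0} +
        {v | ∀ τ, ¬ (τ.1 = true ∧ ∀ p ∈ Q, τ.2.1 ≠ cls p) → v τ = 0}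

theorem ClosedExpr.isSemilinearSet_counts [Finite P'] [Finite L'] (cls : I → P')
    (mem : N → L' → Prop) : ∀ f : ClosedExpr I L V N, IsSemilinearSet (f.counts cls mem)
  | .eps => .singleton 0
  | .edge _ _ => isSemilinearSet_unitCounts _
  | .invEdge _ _ => isSemilinearSet_unitCounts _
  | .seq f g => (f.isSemilinearSet_counts cls mem).add (g.isSemilinearSet_counts cls mem)
  | .alt f g => (f.isSemilinearSet_counts cls mem).union (g.isSemilinearSet_counts cls mem)
  | .star f => (f.isSemilinearSet_counts cls mem).closure

theorem TripleExpr.isSemilinearSet_counts [Finite P'] [Finite L'] (cls : I → P')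
    (mem : N → L' → Prop) (e : TripleExpr I L V N) : IsSemilinearSet (e.counts cls mem) := by
  cases e with
  | invOpen f R => exact (f.isSemilinearSet_counts cls mem).add (isSemilinearSet_vanishing _)
  | open_ f R Q =>
    exact ((f.isSemilinearSet_counts cls mem).add (isSemilinearSet_vanishing _)).add
      (isSemilinearSet_vanishing _)

theorem ClosedExpr.finite_preds : ∀ f : ClosedExpr I L V N, f.preds.Finite
  | .eps => Set.finite_empty
  | .edge _ _ => Set.finite_singleton _
  | .invEdge _ _ => Set.finite_singleton _
  | .seq f g => f.finite_preds.union g.finite_preds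
  | .alt f g => f.finite_preds.union g.finite_preds
  | .star f => f.finite_preds

theorem TripleExpr.finite_preds (e : TripleExpr I L V N) : e.preds.Finite := by
  cases e with
  | invOpen f R => exact f.finite_preds.union R.finite_toSet
  | open_ f R Q => exact (f.finite_preds.union R.finite_toSet).union Q.finite_toSet

theorem ClosedExpr.IsShallow.finite_names :
    ∀ {f : ClosedExpr I L V N}, f.IsShallow → f.names.Finite
  | .eps, _ => by simp [ClosedExpr.names]
  | .edge _ _, ⟨s, h⟩ => by subst h; simp [ClosedExpr.names, Shape.names]
  | .invEdge _ _, ⟨s, h⟩ => by subst h; simp [ClosedExpr.names, Shape.names]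
  | .seq f g, h => by
    rw [ClosedExpr.names]; exact (finite_names (f := f) h.1).union (finite_names (f := g) h.2)
  | .alt f g, h => by
    rw [ClosedExpr.names]; exact (finite_names (f := f) h.1).union (finite_names (f := g) h.2)
  | .star f, h => by rw [ClosedExpr.names]; exact finite_names (f := f) h

theorem TripleExpr.IsShallow.finite_names {e : TripleExpr I L V N} (h : e.IsShallow) :
    e.names.Finite := by
  cases e with
  | invOpen f R => rw [TripleExpr.names]; exact ClosedExpr.IsShallow.finite_names h
  | open_ f R Q => rw [TripleExpr.names]; exact ClosedExpr.IsShallow.finite_names h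

theorem Graph.finite_edges (G : Graph I L B) : G.edges.Finite := by
  refine ((G.finite_toSet.image Triple.edge).union (G.finite_toSet.image Triple.invEdge)).subset ?_
  rintro x ⟨t, ht, rfl | rfl⟩
  · exact Or.inl ⟨t, ht, rfl⟩
  · exact Or.inr ⟨t, ht, rfl⟩

variable {val : V → Set (Term I L B)} {C : Catalogue I L V N} {G : Graph I L B}
  {α : Set (N × Term I L B)} {cls : I → P'} {lab : Term I L B → L'} {mem : N → L' → Prop}

theorem countedBy_edge {p : I} (hp : ∀ q, cls q = cls p → q = p) {s : N}
    (hs : ∀ u, (s, u) ∈ α ↔ mem s (lab u)) :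
    CountedBy (Edge.type cls lab) G.edges ((ClosedExpr.edge p (.name s)).sem val C G α)
      ((ClosedExpr.edge p (.name s) : ClosedExpr I L V N).counts cls mem) := by
  intro X
  rw [ClosedExpr.counts, ← countedBy_singletons G.finite_edges, ClosedExpr.sem]
  constructor
  · rintro ⟨t, ht, rfl, hs', rfl⟩
    exact ⟨t.edge, ⟨t, ht, Or.inl rfl⟩, ⟨rfl, rfl, (hs _).1 hs'⟩, rfl⟩
  · rintro ⟨_, ⟨t, ht, rfl | rfl⟩, ⟨h1, h2, h3⟩, rfl⟩
    · exact ⟨t, ht, hp _ h2, (hs _).2 h3, rfl⟩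
    · exact absurd h1 (by simp [Edge.type, Triple.invEdge])

theorem countedBy_invEdge {p : I} (hp : ∀ q, cls q = cls p → q = p) {s : N}
    (hs : ∀ u, (s, u) ∈ α ↔ mem s (lab u)) :
    CountedBy (Edge.type cls lab) G.edges ((ClosedExpr.invEdge p (.name s)).sem val C G α)
      ((ClosedExpr.invEdge p (.name s) : ClosedExpr I L V N).counts cls mem) := by
  intro X
  rw [ClosedExpr.counts, ← countedBy_singletons G.finite_edges, ClosedExpr.sem]
  constructor
  · rintro ⟨t, ht, rfl, hs', rfl⟩
    exact ⟨t.invEdge, ⟨t, ht, Or.inr rfl⟩, ⟨rfl, rfl, (hs _).1 hs'⟩, rfl⟩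
  · rintro ⟨_, ⟨t, ht, rfl | rfl⟩, ⟨h1, h2, h3⟩, rfl⟩
    · exact absurd h1 (by simp [Edge.type, Triple.edge])
    · exact ⟨t, ht, hp _ h2, (hs _).2 h3, rfl⟩

/-- Matching a shallow closed triple expression is a condition on the type count, provided that the
types determine the predicates that occur and the names that the targets satisfy. -/
theorem ClosedExpr.countedBy : ∀ {f : ClosedExpr I L V N}, f.IsShallow →
    (∀ p ∈ f.preds, ∀ q, cls q = cls p → q = p) →
    (∀ s ∈ f.names, ∀ u, (s, u) ∈ α ↔ mem s (lab u)) →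
    CountedBy (Edge.type cls lab) G.edges (f.sem val C G α) (f.counts cls mem)
  | .eps, _, _, _ => by
    rw [ClosedExpr.sem, ClosedExpr.counts]; exact countedBy_singleton_empty G.finite_edges
  | .edge p _, ⟨s, h⟩, hp, hs => by
    subst h
    exact countedBy_edge (hp p rfl) (hs s (by simp [ClosedExpr.names, Shape.names]))
  | .invEdge p _, ⟨s, h⟩, hp, hs => by
    subst h
    exact countedBy_invEdge (hp p rfl) (hs s (by simp [ClosedExpr.names, Shape.names]))
  | .seq f g, h, hp, hs => by
    rw [ClosedExpr.names] at hs
    rw [ClosedExpr.sem, ClosedExpr.counts]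
    exact (countedBy (f := f) h.1 (fun p hp' => hp p (Or.inl hp'))
        (fun s hs' => hs s (Or.inl hs'))).disjointUnions G.finite_edges
      (countedBy (f := g) h.2 (fun p hp' => hp p (Or.inr hp')) (fun s hs' => hs s (Or.inr hs')))
  | .alt f g, h, hp, hs => by
    rw [ClosedExpr.names] at hs
    rw [ClosedExpr.sem, ClosedExpr.counts]
    exact (countedBy (f := f) h.1 (fun p hp' => hp p (Or.inl hp'))
        (fun s hs' => hs s (Or.inl hs'))).union
      (countedBy (f := g) h.2 (fun p hp' => hp p (Or.inr hp')) (fun s hs' => hs s (Or.inr hs')))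
  | .star f, h, hp, hs => by
    rw [ClosedExpr.names] at hs
    rw [ClosedExpr.sem, ClosedExpr.counts]
    exact (countedBy (f := f) h hp hs).disjointStar G.finite_edges

theorem countedBy_invOutside {R : Finset I} (hR : ∀ p ∈ R, ∀ q, cls q = cls p → q = p) :
    CountedBy (Edge.type cls lab) G.edges (invOutside G R)
      {v | ∀ τ, ¬ (τ.1 = false ∧ ∀ p ∈ R, τ.2.1 ≠ cls p) → v τ = 0} := by
  intro X
  rw [← countedBy_subsets G.finite_edges fun τ : Bool × P' × L' =>
    τ.1 = false ∧ ∀ p ∈ R, τ.2.1 ≠ cls p]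
  refine forall₂_congr fun x _ => ?_
  constructor
  · rintro ⟨t, ht, rfl, h⟩
    exact ⟨⟨t, ht, Or.inr rfl⟩, rfl, fun p hp hc => h (hR p hp _ hc ▸ hp)⟩
  · rintro ⟨⟨t, ht, rfl | rfl⟩, h1, h2⟩
    · exact absurd h1 (by simp [Edge.type, Triple.edge])
    · exact ⟨t, ht, rfl, fun h => h2 _ h rfl⟩

theorem countedBy_fwdOutside {R : Finset I} (hR : ∀ p ∈ R, ∀ q, cls q = cls p → q = p) :
    CountedBy (Edge.type cls lab) G.edges (fwdOutside G R)
      {v | ∀ τ, ¬ (τ.1 = true ∧ ∀ p ∈ R, τ.2.1 ≠ cls p) → v τ = 0} := by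
  intro X
  rw [← countedBy_subsets G.finite_edges fun τ : Bool × P' × L' =>
    τ.1 = true ∧ ∀ p ∈ R, τ.2.1 ≠ cls p]
  refine forall₂_congr fun x _ => ?_
  constructor
  · rintro ⟨t, ht, rfl, h⟩
    exact ⟨⟨t, ht, Or.inl rfl⟩, rfl, fun p hp hc => h (hR p hp _ hc ▸ hp)⟩
  · rintro ⟨⟨t, ht, rfl | rfl⟩, h1, h2⟩
    · exact ⟨t, ht, rfl, fun h => h2 _ h rfl⟩
    · exact absurd h1 (by simp [Edge.type, Triple.invEdge])

theorem TripleExpr.countedBy {e : TripleExpr I L V N} (h : e.IsShallow)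
    (hp : ∀ p ∈ e.preds, ∀ q, cls q = cls p → q = p)
    (hs : ∀ s ∈ e.names, ∀ u, (s, u) ∈ α ↔ mem s (lab u)) :
    CountedBy (Edge.type cls lab) G.edges (e.sem val C G α) (e.counts cls mem) := by
  cases e with
  | invOpen f R =>
    rw [TripleExpr.names] at hs
    rw [TripleExpr.sem, TripleExpr.counts]
    exact (ClosedExpr.countedBy (f := f) h (fun p hp' => hp p (Or.inl hp')) hs).disjointUnions
      G.finite_edges (countedBy_invOutside fun p hp' => hp p (Or.inr hp'))
  | open_ f R Q =>
    rw [TripleExpr.names] at hs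
    rw [TripleExpr.sem, TripleExpr.counts]
    exact ((ClosedExpr.countedBy (f := f) h (fun p hp' => hp p (Or.inl (Or.inl hp')))
      hs).disjointUnions G.finite_edges
        (countedBy_invOutside fun p hp' => hp p (Or.inl (Or.inr hp')))).disjointUnions
      G.finite_edges (countedBy_fwdOutside fun p hp' => hp p (Or.inr hp'))

/-- The neighbourhood of a node matches a shallow triple expression if and only if its type count
lies in a semilinear set that depends on the expression only. -/
theorem neigh_mem_sem_iff {e : TripleExpr I L V N} (h : e.IsShallow)
    (hp : ∀ p ∈ e.preds, ∀ q, cls q = cls p → q = p)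
    (hs : ∀ s ∈ e.names, ∀ u, (s, u) ∈ α ↔ mem s (lab u)) (v : Term I L B) :
    G.neigh v ∈ e.sem val C G α ↔ typeCount (Edge.type cls lab) (G.neigh v) ∈ e.counts cls mem :=
  (TripleExpr.countedBy h hp hs _).trans (and_iff_right fun _ hx => hx.1)

end ShEx

/-! ### Registers, stacks and elementary loops -/

namespace ShEx

/-- The control state of the decision program. `Q` is the state set of the automaton that recognizes
the relevant words, `N'` the set of relevant shape names. -/
structure Reg (Q N' : Type) : Type where
  /-- the symbol popped last -/
  sym : Option Sym
  /-- the symbol with which it is compared -/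
  aux : Option Sym
  /-- the result of a comparison -/
  eq : Bool
  /-- the state of the automaton -/
  q : Q
  /-- the state of the automaton after the predicate of the current triple -/
  pred : Q
  /-- the names assigned to the term looked up last -/
  names : Finset N'
  /-- whether the term looked up last is the input node -/
  isNode : Bool
  /-- `names` for the subject of the current triple -/
  srcNames : Finset N'
  /-- `isNode` for the subject of the current triple -/
  srcIsNode : Bool
  /-- the answer -/
  ok : Bool

/-- The stacks of the decision program: `inp` holds the input and later only the node and the
assignment, `tri` the triples, `reg` and `tmp` the two parts of the term that is looked up, `done`
the part of `inp` already scanned. The stacks `pos τ` and `neg τ` hold the positive and the negative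
part of an integer in unary, `tok j` and `used j` are loop counters. -/
inductive Stk (T : Type) (m : ℕ) : Type
  | inp | tri | reg | tmp | done
  | pos (τ : T)
  | neg (τ : T)
  | tok (j : Fin (m + 1))
  | used (j : Fin (m + 1))
  deriving DecidableEq

instance {Q N' : Type} [Finite Q] [Finite N'] : Finite (Reg Q N') :=
  Finite.of_injective (β := (Option Sym × Option Sym × Bool × Q × Q) ×
      (Finset N' × Bool × Finset N' × Bool × Bool))
    (fun s => ((s.sym, s.aux, s.eq, s.q, s.pred),
      (s.names, s.isNode, s.srcNames, s.srcIsNode, s.ok)))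
    fun s s' h => by cases s; cases s'; simp_all

instance {T : Type} {m : ℕ} [Finite T] : Finite (Stk T m) :=
  Finite.of_surjective (α := Fin 5 ⊕ ((T ⊕ T) ⊕ (Fin (m + 1) ⊕ Fin (m + 1))))
    (fun x => match x with
      | .inl 0 => .inp
      | .inl 1 => .tri
      | .inl 2 => .reg
      | .inl 3 => .tmp
      | .inl 4 => .done
      | .inr (.inl (.inl τ)) => .pos τ
      | .inr (.inl (.inr τ)) => .neg τ
      | .inr (.inr (.inl j)) => .tok j
      | .inr (.inr (.inr j)) => .used j)
    fun k => by
      cases k with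
      | inp => exact ⟨.inl 0, rfl⟩
      | tri => exact ⟨.inl 1, rfl⟩
      | reg => exact ⟨.inl 2, rfl⟩
      | tmp => exact ⟨.inl 3, rfl⟩
      | done => exact ⟨.inl 4, rfl⟩
      | pos τ => exact ⟨.inr (.inl (.inl τ)), rfl⟩
      | neg τ => exact ⟨.inr (.inl (.inr τ)), rfl⟩
      | tok j => exact ⟨.inr (.inr (.inl j)), rfl⟩
      | used j => exact ⟨.inr (.inr (.inr j)), rfl⟩

/-- The contents of the stacks that hold words, the top of a stack first. -/
structure Work : Type where
  inp : List Sym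
  tri : List Sym
  reg : List Sym
  tmp : List Sym
  done : List Sym

/-- Stack contents with the words `w`, the integers `z` and the loop counters `t` and `u`. At least one
of the stacks `pos τ` and `neg τ` is empty, so that the contents are determined by `z τ`. -/
def stk {T : Type} {m : ℕ} (w : Work) (z : T → ℤ) (t u : Fin (m + 1) → ℕ) : Stk T m → List Sym
  | .inp => w.inp
  | .tri => w.tri
  | .reg => w.reg
  | .tmp => w.tmp
  | .done => w.done
  | .pos τ => List.replicate (z τ).toNat .close
  | .neg τ => List.replicate (-z τ).toNat .close
  | .tok j => List.replicate (t j) .close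
  | .used j => List.replicate (u j) .close

/-- Programs of the decision procedure. -/
abbrev DProg (T : Type) (m : ℕ) (Q N' ι : Type) : Type := Prog (Stk T m) (Reg Q N') Sym ι

end ShEx

namespace Prog

theorem Runs.seqs_nil {K σ A ι : Type} [DecidableEq K] {a : σ × (K → List A)} {t : ℕ}
    (ht : 1 ≤ t) : Runs (seqs [] : Prog K σ A ι) a a t :=
  .load id a.1 a.2 t ht

theorem Runs.seqs_cons {K σ A ι : Type} [DecidableEq K] {P : Prog K σ A ι}
    {l : List (Prog K σ A ι)} {a b c : σ × (K → List A)} {t₁ t₂ t : ℕ} (hP : Runs P a b t₁)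
    (hl : Runs (seqs l) b c t₂) (ht : t₁ + t₂ ≤ t) : Runs (seqs (P :: l)) a c t :=
  .seq hP hl ht

end Prog

namespace ShEx

open Prog

variable {T : Type} {m : ℕ} {Q N' ι : Type}

section

variable {w : Work} {z : T → ℤ} {t u : Fin (m + 1) → ℕ}

/-- Pop a symbol into the register `sym`. -/
def popSym (k : Stk T m) : DProg T m Q N' ι := .pop k fun s a => { s with sym := a }

/-- Push the symbol in the register `sym`. -/
def pushSym (k : Stk T m) : DProg T m Q N' ι := .push k fun s => s.sym.getD .close

/-- Pop the symbols of a stack one after the other, and run a program after each. -/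
def forEach (k : Stk T m) (P : DProg T m Q N' ι) : DProg T m Q N' ι :=
  .seq (popSym k) (.loop (fun s => s.sym.isSome) (.seq P (popSym k)))

variable [DecidableEq T]

@[simp] theorem update_inp (l : List Sym) :
    Function.update (stk w z t u) .inp l = stk { w with inp := l } z t u := by
  funext k; cases k <;> simp [stk]

@[simp] theorem update_tri (l : List Sym) :
    Function.update (stk w z t u) .tri l = stk { w with tri := l } z t u := by
  funext k; cases k <;> simp [stk]

@[simp] theorem update_reg (l : List Sym) :
    Function.update (stk w z t u) .reg l = stk { w with reg := l } z t u := by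
  funext k; cases k <;> simp [stk]

@[simp] theorem update_tmp (l : List Sym) :
    Function.update (stk w z t u) .tmp l = stk { w with tmp := l } z t u := by
  funext k; cases k <;> simp [stk]

@[simp] theorem update_done (l : List Sym) :
    Function.update (stk w z t u) .done l = stk { w with done := l } z t u := by
  funext k; cases k <;> simp [stk]

theorem update_tok (j : Fin (m + 1)) (n : ℕ) :
    Function.update (stk w z t u) (.tok j) (List.replicate n .close) =
      stk w z (Function.update t j n) u := by
  funext k
  cases k with
  | tok i =>
    by_cases h : i = j
    · subst h; simp [stk]
    · simp [stk, h]
  | _ => simp [stk]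

theorem update_used (j : Fin (m + 1)) (n : ℕ) :
    Function.update (stk w z t u) (.used j) (List.replicate n .close) =
      stk w z t (Function.update u j n) := by
  funext k
  cases k with
  | used i =>
    by_cases h : i = j
    · subst h; simp [stk]
    · simp [stk, h]
  | _ => simp [stk]

theorem forEach_nil {k : Stk T m} {P : DProg T m Q N' ι} {s : Reg Q N'} {S : Stk T m → List Sym}
    (h : S k = []) : Runs (forEach k P) (s, S) ({ s with sym := none }, S) 2 := by
  refine .seq (.pop k _ s S 1 le_rfl) (t₂ := 1) ?_ le_rfl
  have : Function.update S k (S k).tail = S := by rw [h, List.tail_nil, ← h, Function.update_eq_self]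
  rw [this, h]
  exact .loop_false rfl le_rfl

theorem forEach_cons {k : Stk T m} {P : DProg T m Q N' ι} {s : Reg Q N'} {S : Stk T m → List Sym}
    {a : Sym} {l : List Sym} {b c : Reg Q N' × (Stk T m → List Sym)} {t₁ t₂ t : ℕ}
    (h : S k = a :: l) (hP : Runs P ({ s with sym := some a }, Function.update S k l) b t₁)
    (hL : Runs (forEach k P) b c t₂) (ht : t₁ + t₂ + 2 ≤ t) : Runs (forEach k P) (s, S) c t := by
  cases hL with
  | seq h1 h2 ht' =>
    refine .seq (.pop k _ s S 1 le_rfl) (t₂ := t - 1) ?_ (by omega)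
    rw [h]
    exact .loop_true rfl (.seq hP h1 le_rfl) h2 (by omega)

/-! ### Integer counters -/

/-- Increment an integer. -/
def incr (τ : T) : DProg T m Q N' ι :=
  seqs [popSym (.neg τ), .ite (fun s => s.sym.isSome) (.load id) (.push (.pos τ) fun _ => .close),
    .load fun s => { s with sym := none }]

/-- Decrement an integer. -/
def decr (τ : T) : DProg T m Q N' ι :=
  seqs [popSym (.pos τ), .ite (fun s => s.sym.isSome) (.load id) (.push (.neg τ) fun _ => .close),
    .load fun s => { s with sym := none }]

theorem runs_incr (τ : T) (s : Reg Q N') :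
    Runs (incr τ : DProg T m Q N' ι) (s, stk w z t u)
      ({ s with sym := none }, stk w (z + Pi.single τ 1) t u) 6 := by
  refine Straight.runs' (by simp [incr, Straight, popSym]) ?_ (by simp [incr, cost, popSym])
  rcases lt_or_ge (z τ) 0 with hz | hz
  · obtain ⟨n, hn⟩ : ∃ n : ℕ, z τ = -(n + 1 : ℕ) := ⟨(-z τ).toNat - 1, by omega⟩
    have e : stk (m := m) w z t u (.neg τ) = .close :: List.replicate n .close := by
      simp only [stk, hn, neg_neg, Int.toNat_natCast, List.replicate_succ]
    simp only [incr, seqs_cons, seqs_nil, exec, popSym, e, List.head?_cons, List.tail_cons,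
      Option.isSome_some, if_true, id]
    congr 1
    funext k
    cases k with
    | pos σ =>
      by_cases h : σ = τ
      · subst h
        simp [stk, hn]
      · simp [stk, h]
    | neg σ =>
      by_cases h : σ = τ
      · subst h
        simp [stk, hn]
      · simp [stk, h]
    | _ => simp [stk]
  · obtain ⟨n, hn⟩ : ∃ n : ℕ, z τ = n := ⟨(z τ).toNat, by omega⟩
    have e : stk (m := m) w z t u (.neg τ) = [] := by
      simp [stk, hn]
    simp only [incr, seqs_cons, seqs_nil, exec, popSym, e, List.head?_nil, List.tail_nil,
      Option.isSome_none, id, Bool.false_eq_true, if_false]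
    congr 1
    funext k
    cases k with
    | pos σ =>
      by_cases h : σ = τ
      · subst h
        have : ((n : ℤ) + 1).toNat = n + 1 := by omega
        simp [stk, hn, this, List.replicate_succ]
      · simp [stk, h]
    | neg σ =>
      by_cases h : σ = τ
      · subst h
        simp [stk, hn]
      · simp [stk, h]
    | _ => simp [stk]

theorem runs_decr (τ : T) (s : Reg Q N') :
    Runs (decr τ : DProg T m Q N' ι) (s, stk w z t u)
      ({ s with sym := none }, stk w (z - Pi.single τ 1) t u) 6 := by
  refine Straight.runs' (by simp [decr, Straight, popSym]) ?_ (by simp [decr, cost, popSym])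
  rcases lt_or_ge 0 (z τ) with hz | hz
  · obtain ⟨n, hn⟩ : ∃ n : ℕ, z τ = (n + 1 : ℕ) := ⟨(z τ).toNat - 1, by omega⟩
    have e : stk (m := m) w z t u (.pos τ) = .close :: List.replicate n .close := by
      simp only [stk, hn, Int.toNat_natCast, List.replicate_succ]
    simp only [decr, seqs_cons, seqs_nil, exec, popSym, e, List.head?_cons, List.tail_cons,
      Option.isSome_some, if_true, id]
    congr 1
    funext k
    cases k with
    | pos σ =>
      by_cases h : σ = τ
      · subst h
        simp [stk, hn]
      · simp [stk, h]
    | neg σ =>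
      by_cases h : σ = τ
      · subst h
        simp [stk, hn]
      · simp [stk, h]
    | _ => simp [stk]
  · obtain ⟨n, hn⟩ : ∃ n : ℕ, z τ = -(n : ℤ) := ⟨(-z τ).toNat, by omega⟩
    have e : stk (m := m) w z t u (.pos τ) = [] := by
      simp [stk, hn]
    simp only [decr, seqs_cons, seqs_nil, exec, popSym, e, List.head?_nil, List.tail_nil,
      Option.isSome_none, id, Bool.false_eq_true, if_false]
    congr 1
    funext k
    cases k with
    | neg σ =>
      by_cases h : σ = τ
      · subst h
        have : (1 + (n : ℤ)).toNat = n + 1 := by omega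
        simp [stk, hn, this, List.replicate_succ]
      · simp [stk, h]
    | pos σ =>
      by_cases h : σ = τ
      · subst h
        simp [stk, hn]
      · simp [stk, h]
    | _ => simp [stk]

/-- The vector that counts the occurrences in a list. Vectors with entries in `ℕ` are represented by
such lists in the program. -/
def vec (l : List T) : T → ℤ := fun τ => l.count τ

@[simp] theorem vec_nil : vec ([] : List T) = 0 := by funext τ; simp [vec]

theorem vec_cons (τ : T) (l : List T) : vec (τ :: l) = Pi.single τ 1 + vec l := by
  funext σ
  by_cases h : σ = τ
  · subst h; simp [vec, add_comm]
  · simp [vec, h, Ne.symm h]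

/-- Add a fixed vector to the integers. -/
def addVec (l : List T) : DProg T m Q N' ι := seqs (.load (fun s => { s with sym := none }) :: l.map incr)

/-- Subtract a fixed vector from the integers. -/
def subVec (l : List T) : DProg T m Q N' ι := seqs (.load (fun s => { s with sym := none }) :: l.map decr)

theorem runs_addVec (l : List T) (s : Reg Q N') :
    Runs (addVec l : DProg T m Q N' ι) (s, stk w z t u)
      ({ s with sym := none }, stk w (z + vec l) t u) (6 * l.length + 2) := by
  refine .seqs_cons (.load _ _ _ 1 le_rfl) (t₂ := 6 * l.length + 1) ?_ (by omega)
  induction l generalizing z with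
  | nil => simpa using Runs.seqs_nil le_rfl
  | cons τ l ih =>
    rw [vec_cons, ← add_assoc]
    exact .seqs_cons (runs_incr τ _) (ih (z := z + Pi.single τ 1))
      (by simp only [List.length_cons]; omega)

theorem runs_subVec (l : List T) (s : Reg Q N') :
    Runs (subVec l : DProg T m Q N' ι) (s, stk w z t u)
      ({ s with sym := none }, stk w (z - vec l) t u) (6 * l.length + 2) := by
  refine .seqs_cons (.load _ _ _ 1 le_rfl) (t₂ := 6 * l.length + 1) ?_ (by omega)
  induction l generalizing z with
  | nil => simpa using Runs.seqs_nil le_rfl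
  | cons τ l ih =>
    rw [vec_cons, ← sub_sub]
    exact .seqs_cons (runs_decr τ _) (ih (z := z - Pi.single τ 1))
      (by simp only [List.length_cons]; omega)

/-- Set the register `eq` to `false` if a stack is not empty. -/
def testEmpty (k : Stk T m) : DProg T m Q N' ι :=
  seqs [popSym k, .ite (fun s => s.sym.isSome)
    (.seq (pushSym k) (.load fun s => { s with eq := false, sym := none })) (.load id)]

theorem runs_testEmpty (k : Stk T m) (s : Reg Q N') (S : Stk T m → List Sym) :
    Runs (testEmpty k : DProg T m Q N' ι) (s, S)
      ({ s with sym := none, eq := s.eq && (S k).isEmpty }, S) 6 := by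
  refine Straight.runs' (by simp [testEmpty, Straight, popSym, pushSym]) ?_
    (by simp [testEmpty, cost, popSym, pushSym])
  cases h : S k with
  | nil =>
    have : Function.update S k [] = S := by rw [← h, Function.update_eq_self]
    simp [testEmpty, exec, popSym, h, this]
  | cons a l =>
    have : Function.update S k (a :: l) = S := by rw [← h, Function.update_eq_self]
    simp [testEmpty, exec, popSym, pushSym, h, this]

theorem runs_testEmpties (ks : List (Stk T m)) (s : Reg Q N') (S : Stk T m → List Sym) :
    Runs (seqs (.load (fun s => { s with sym := none }) :: ks.map testEmpty) : DProg T m Q N' ι)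
      (s, S) ({ s with sym := none, eq := s.eq && ks.all fun k => (S k).isEmpty }, S)
      (6 * ks.length + 2) := by
  refine .seqs_cons (.load _ _ _ 1 le_rfl) (t₂ := 6 * ks.length + 1) ?_ (by omega)
  induction ks generalizing s with
  | nil => simpa using Runs.seqs_nil le_rfl
  | cons k ks ih =>
    refine .seqs_cons (runs_testEmpty k _ S) (t₂ := 6 * ks.length + 1) ?_
      (by simp only [List.length_cons]; omega)
    simpa [Bool.and_assoc] using ih { s with eq := s.eq && (S k).isEmpty }

end

end ShEx

/-! ### Membership in semilinear sets by exhaustive search -/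

namespace ShEx

open Prog

variable {T : Type} {m : ℕ} {Q N' ι : Type} [DecidableEq T]
  {w : Work} {z : T → ℤ} {t u : Fin (m + 1) → ℕ}

/-- The vector `z` is a combination of the given vectors with coefficients at most `n`. -/
def InSpan (n : ℕ) : List (List T) → (T → ℤ) → Prop
  | [], z => z = 0
  | p :: ps, z => ∃ c ≤ n, InSpan n ps (z - c • vec p)

theorem exists_vec [Finite T] (v : T → ℕ) : ∃ l : List T, vec l = fun τ => (v τ : ℤ) := by
  have := Fintype.ofFinite T
  refine ⟨(Finset.univ : Finset T).toList.flatMap fun τ => List.replicate (v τ) τ, ?_⟩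
  funext σ
  simp only [vec, List.count_flatMap, Nat.cast_inj]
  rw [Finset.sum_map_toList]
  simp [List.count_replicate]

/-- `vec` with values in the natural numbers. -/
def natVec (l : List T) : T → ℕ := fun τ => l.count τ

/-- Combinations with bounded coefficients lie in the submonoid that the vectors generate. -/
theorem InSpan.exists_mem_closure {n : ℕ} {ps : List (List T)} {z : T → ℤ} (h : InSpan n ps z) :
    ∃ y ∈ AddSubmonoid.closure (natVec '' {p | p ∈ ps}), z = fun τ => (y τ : ℤ) := by
  induction ps generalizing z with
  | nil => exact ⟨0, zero_mem _, by rw [show z = 0 from h]; rfl⟩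
  | cons p ps ih =>
    obtain ⟨c, -, hc⟩ := h
    obtain ⟨y, hy, e⟩ := ih hc
    have hp : natVec p ∈ AddSubmonoid.closure (natVec '' {q | q ∈ p :: ps}) :=
      AddSubmonoid.subset_closure ⟨p, List.mem_cons_self, rfl⟩
    refine ⟨c • natVec p + y, add_mem (nsmul_mem hp c) (AddSubmonoid.closure_mono
        (Set.image_mono fun q hq => List.mem_cons_of_mem p hq) hy), ?_⟩
    rw [sub_eq_iff_eq_add] at e
    rw [e]
    funext τ
    simp [natVec, vec, add_comm]

/-- The entries of a vector bound the coefficients of its combinations of nonzero vectors. -/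
theorem inSpan_of_mem_closure {n : ℕ} {ps : List (List T)} {y : T → ℕ}
    (hy : y ∈ AddSubmonoid.closure (natVec '' {p | p ∈ ps})) (hn : ∀ τ, y τ ≤ n) :
    InSpan n ps fun τ => (y τ : ℤ) := by
  induction ps generalizing y with
  | nil =>
    have : y = 0 := by simpa using hy
    subst this
    rfl
  | cons p ps ih =>
    have hset : {q | q ∈ p :: ps} = {p} ∪ {q | q ∈ ps} := by ext q; simp
    rw [hset, Set.image_union, Set.image_singleton, AddSubmonoid.closure_union,
      AddSubmonoid.mem_sup] at hy
    obtain ⟨_, hx, y', hy', rfl⟩ := hy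
    obtain ⟨c, rfl⟩ := AddSubmonoid.mem_closure_singleton.1 hx
    have ih' := ih hy' fun τ => (Nat.le_add_left _ _).trans (hn τ)
    -- The coefficient of a zero vector may be arbitrarily large, and is replaced by `0`.
    by_cases hp : ∃ τ, natVec p τ ≠ 0
    · obtain ⟨τ, hτ⟩ := hp
      refine ⟨c, ?_, ?_⟩
      · calc c ≤ c * natVec p τ := Nat.le_mul_of_pos_right c (Nat.pos_of_ne_zero hτ)
          _ ≤ (c • natVec p + y') τ := by simp
          _ ≤ n := hn τ
      · convert ih' using 1
        funext τ
        simp [natVec, vec]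
    · push Not at hp
      refine ⟨0, Nat.zero_le _, ?_⟩
      convert ih' using 1
      funext τ
      simp [hp τ]

/-- A semilinear set is decided by a search over finitely many lists of coefficients. -/
theorem exists_search_of_isSemilinearSet [Finite T] {S : Set (T → ℕ)} (hS : IsSemilinearSet S) :
    ∃ F : List (List T × List (List T)), ∀ (v : T → ℕ) (n : ℕ), (∀ τ, v τ ≤ n) →
      (v ∈ S ↔ ∃ x ∈ F, InSpan n x.2 ((fun τ => (v τ : ℤ)) - vec x.1)) := by
  obtain ⟨S', hS', rfl⟩ := isSemilinearSet_iff.1 hS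
  have key : ∀ t ∈ S', ∃ x : List T × List (List T), ∀ (v : T → ℕ) (n : ℕ), (∀ τ, v τ ≤ n) →
      (v ∈ t ↔ InSpan n x.2 ((fun τ => (v τ : ℤ)) - vec x.1)) := by
    intro t ht
    obtain ⟨a, P, rfl⟩ := isLinearSet_iff.1 (hS' t ht)
    choose f hf using exists_vec (T := T)
    have hf' : ∀ v, natVec (f v) = v := fun v => funext fun τ => by
      have := congrFun (hf v) τ
      simpa [vec, natVec] using this
    have hP : natVec '' {p | p ∈ P.toList.map f} = P := by
      ext v
      simp only [List.mem_map, Finset.mem_toList, Set.mem_image, Set.mem_ofPred_eq, Finset.mem_coe]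
      constructor
      · rintro ⟨_, ⟨v', hv', rfl⟩, rfl⟩
        rwa [hf']
      · exact fun hv => ⟨f v, ⟨v, hv, rfl⟩, hf' v⟩
    refine ⟨(f a, P.toList.map f), fun v n hn => ?_⟩
    rw [Set.mem_vadd_set]
    constructor
    · rintro ⟨y, hy, rfl⟩
      have h := inSpan_of_mem_closure (n := n) (ps := P.toList.map f) (y := y) (by rwa [hP])
        fun τ => (Nat.le_add_left _ _).trans (hn τ)
      convert h using 1
      rw [hf]
      funext τ
      simp
    · intro h
      obtain ⟨y, hy, e⟩ := h.exists_mem_closure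
      rw [hP] at hy
      refine ⟨y, hy, ?_⟩
      rw [hf] at e
      funext τ
      have := congrFun e τ
      simp only [Pi.sub_apply] at this
      simp only [vadd_eq_add, Pi.add_apply]
      omega
  choose! X hX using key
  refine ⟨S'.toList.map X, fun v n hn => ?_⟩
  simp only [Set.mem_sUnion, Finset.mem_coe, List.mem_map, Finset.mem_toList]
  constructor
  · rintro ⟨t, ht, hv⟩
    exact ⟨X t, ⟨t, ht, rfl⟩, (hX t ht v n hn).1 hv⟩
  · rintro ⟨_, ⟨t, ht, rfl⟩, h⟩
    exact ⟨t, ht, (hX t ht v n hn).2 h⟩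

/-- The index of the loop counter of level `i`, for `i ≤ m`. -/
def level (m i : ℕ) : Fin (m + 1) := Fin.ofNat (m + 1) i

theorem level_ne {i j : ℕ} (h : i < j) (hj : j ≤ m) : level m i ≠ level m j := by
  intro e
  have := congrArg Fin.val e
  simp only [level, Fin.val_ofNat, Nat.mod_eq_of_lt (show i < m + 1 by omega),
    Nat.mod_eq_of_lt (show j < m + 1 by omega)] at this
  omega

/-- The loop that subtracts the vector `p` in each round, and then runs a program `P` that sets `ok` if
the integers satisfy `I`. -/
theorem runs_descend {P : DProg T m Q N' ι} {I : (T → ℤ) → Prop} {j : Fin (m + 1)} {B : ℕ}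
    (p : List T)
    (hP : ∀ (z : T → ℤ) (a b : ℕ) (s : Reg Q N'), ∃ ok', (ok' = true ↔ s.ok = true ∨ I z) ∧
      Runs P (s, stk w z (Function.update t j a) (Function.update u j b))
        ({ s with sym := none, eq := false, ok := ok' },
          stk w z (Function.update t j a) (Function.update u j b)) B)
    (r c : ℕ) (s : Reg Q N') (hs : s.eq = false) (z : T → ℤ) :
    ∃ ok', (ok' = true ↔ s.ok = true ∨ ∃ d, 1 ≤ d ∧ d ≤ r ∧ I (z - d • vec p)) ∧
      Runs (forEach (.tok j) (seqs [.push (.used j) fun _ => .close, subVec p, P]))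
        (s, stk w z (Function.update t j r) (Function.update u j c))
        ({ s with sym := none, ok := ok' },
          stk w (z - r • vec p) (Function.update t j 0) (Function.update u j (c + r)))
        (r * (B + 6 * p.length + 6) + 2) := by
  induction r generalizing c s z with
  | zero =>
    refine ⟨s.ok, ?_, ?_⟩
    · refine ⟨Or.inl, ?_⟩
      rintro (h | ⟨d, h1, h2, -⟩)
      · exact h
      · omega
    · have h := forEach_nil (k := .tok j) (s := s)
        (P := seqs [.push (.used j) fun _ => .close, subVec p, P])
        (S := stk w z (Function.update t j 0) (Function.update u j c)) (by simp [stk])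
      simpa using h
  | succ r ih =>
    have e1 : stk w z (Function.update t j (r + 1)) (Function.update u j c) (.tok j) =
        .close :: List.replicate r .close := by
      simp [stk, List.replicate_succ]
    have e2 : Function.update (stk w z (Function.update t j (r + 1)) (Function.update u j c))
        (.tok j) (List.replicate r .close) =
        stk w z (Function.update t j r) (Function.update u j c) := by
      rw [update_tok, Function.update_idem]
    have e3 : Function.update (stk w z (Function.update t j r) (Function.update u j c))
        (.used j) (.close :: stk w z (Function.update t j r) (Function.update u j c) (.used j)) =
        stk w z (Function.update t j r) (Function.update u j (c + 1)) := by
      have : stk w z (Function.update t j r) (Function.update u j c) (.used j) =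
        List.replicate c .close := by simp [stk]
      rw [this, ← List.replicate_succ, update_used, Function.update_idem]
    obtain ⟨ok₁, hok₁, h₁⟩ := hP (z - vec p) r (c + 1)
      { s with sym := none, eq := false }
    obtain ⟨ok₂, hok₂, h₂⟩ := ih (c + 1) { s with sym := none, eq := false, ok := ok₁ } rfl
      (z - vec p)
    refine ⟨ok₂, ?_, ?_⟩
    · rw [hok₂, hok₁, or_assoc]
      refine or_congr_right ⟨?_, ?_⟩
      · rintro (h | ⟨d, hd1, hd2, h⟩)
        · exact ⟨1, le_rfl, by omega, by simpa using h⟩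
        · exact ⟨d + 1, by omega, by omega, by rwa [add_smul, one_smul, add_comm, ← sub_sub]⟩
      · rintro ⟨d, hd1, hd2, h⟩
        obtain ⟨d, rfl⟩ : ∃ d', d = d' + 1 := ⟨d - 1, by omega⟩
        rw [add_smul, one_smul, add_comm, ← sub_sub] at h
        rcases Nat.eq_zero_or_pos d with rfl | hd
        · exact Or.inl (by simpa using h)
        · exact Or.inr ⟨d, hd, by omega, h⟩
    · rw [sub_sub, ← succ_nsmul', add_assoc c, add_comm 1 r] at h₂
      have hs' : s = { s with eq := false } := by cases s; simp_all
      rw [hs']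
      refine forEach_cons (t₁ := B + 6 * p.length + 4) e1 ?_ h₂ (by rw [Nat.succ_mul r]; omega)
      rw [e2]
      refine .seqs_cons (.push _ _ _ _ 1 le_rfl) ?_ (t₂ := B + 6 * p.length + 3) (by omega)
      rw [e3]
      exact .seqs_cons (runs_subVec p _) (.seqs_cons h₁ (.seqs_nil le_rfl) le_rfl) (by omega)

/-- The loop that adds the vector `p` in each round. -/
theorem runs_ascend {j : Fin (m + 1)} (p : List T) (r c : ℕ) (s : Reg Q N') (z : T → ℤ) :
    Runs (forEach (.used j) (seqs [.push (.tok j) fun _ => .close, addVec p]) : DProg T m Q N' ι)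
      (s, stk w z (Function.update t j c) (Function.update u j r))
      ({ s with sym := none },
        stk w (z + r • vec p) (Function.update t j (c + r)) (Function.update u j 0))
      (r * (6 * p.length + 6) + 2) := by
  induction r generalizing c s z with
  | zero =>
    have h := forEach_nil (k := .used j) (s := s) (ι := ι)
      (P := seqs [.push (.tok j) fun _ => .close, addVec p])
      (S := stk w z (Function.update t j c) (Function.update u j 0)) (by simp [stk])
    simpa using h
  | succ r ih =>
    have e1 : stk w z (Function.update t j c) (Function.update u j (r + 1)) (.used j) =
        .close :: List.replicate r .close := by
      simp [stk, List.replicate_succ]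
    have e2 : Function.update (stk w z (Function.update t j c) (Function.update u j (r + 1)))
        (.used j) (List.replicate r .close) =
        stk w z (Function.update t j c) (Function.update u j r) := by
      rw [update_used, Function.update_idem]
    have e3 : Function.update (stk w z (Function.update t j c) (Function.update u j r))
        (.tok j) (.close :: stk w z (Function.update t j c) (Function.update u j r) (.tok j)) =
        stk w z (Function.update t j (c + 1)) (Function.update u j r) := by
      have : stk w z (Function.update t j c) (Function.update u j r) (.tok j) =
        List.replicate c .close := by simp [stk]
      rw [this, ← List.replicate_succ, update_tok, Function.update_idem]
    have h₂ := ih (c + 1) { s with sym := none } (z + vec p)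
    rw [add_assoc z, ← succ_nsmul', add_assoc c, add_comm 1 r] at h₂
    refine forEach_cons (t₁ := 6 * p.length + 4) e1 ?_ h₂ (by rw [Nat.succ_mul r]; omega)
    rw [e2]
    refine .seqs_cons (.push _ _ _ _ 1 le_rfl) ?_ (t₂ := 6 * p.length + 3) (by omega)
    rw [e3]
    exact .seqs_cons (runs_addVec p _) (.seqs_nil le_rfl) le_rfl

variable [Fintype T]

/-- Set `ok` if all integers vanish. -/
noncomputable def testZero : DProg T m Q N' ι :=
  seqs [.load fun s => { s with eq := true },
    seqs (.load (fun s => { s with sym := none }) ::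
      (Finset.univ.toList.map Stk.pos ++ Finset.univ.toList.map Stk.neg).map testEmpty),
    .load fun s => { s with ok := s.ok || s.eq, eq := false }]

theorem runs_testZero (s : Reg Q N') : ∃ b, (b = true ↔ s.ok = true ∨ z = 0) ∧
    Runs (testZero : DProg T m Q N' ι) (s, stk w z t u)
      ({ s with sym := none, eq := false, ok := b }, stk w z t u) (12 * Fintype.card T + 6) := by
  set ks : List (Stk T m) := Finset.univ.toList.map Stk.pos ++ Finset.univ.toList.map Stk.neg
    with hks
  have hlen : ks.length = 2 * Fintype.card T := by
    simp [hks, two_mul]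
  have hz : (ks.all fun k => (stk w z t u k).isEmpty) = true ↔ z = 0 := by
    simp only [hks, List.all_eq_true, List.mem_append, List.mem_map, Finset.mem_toList,
      Finset.mem_univ, true_and, List.isEmpty_iff]
    constructor
    · intro h
      funext τ
      have h1 := h _ (Or.inl ⟨τ, rfl⟩)
      have h2 := h _ (Or.inr ⟨τ, rfl⟩)
      simp only [stk, List.replicate_eq_nil_iff] at h1 h2
      simp only [Pi.zero_apply]
      omega
    · rintro rfl k (⟨τ, rfl⟩ | ⟨τ, rfl⟩) <;> simp [stk]
  refine ⟨s.ok || ks.all fun k => (stk w z t u k).isEmpty, by simp [← hz], ?_⟩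
  have h := runs_testEmpties (ι := ι) ks { s with eq := true } (stk w z t u)
  rw [hlen] at h
  exact .seqs_cons (.load _ _ _ 1 le_rfl) (.seqs_cons h
    (.seqs_cons (.load _ _ _ 1 le_rfl) (.seqs_nil le_rfl) le_rfl) le_rfl) (by omega)

/-- Nested loops over the coefficients of the given vectors: subtract each of the combinations from
the integers, set `ok` if all of them vanish, and restore the integers. The stack `tok i` holds the
number of rounds of the loop of level `i`; during the loop they move to `used i`, and back when the
subtractions are undone. -/
noncomputable def search : List (List T) → DProg T m Q N' ι
  | [] => testZero
  | p :: ps => seqs [search ps,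
      forEach (.tok (level m ps.length))
        (seqs [.push (.used (level m ps.length)) fun _ => .close, subVec p, search ps]),
      forEach (.used (level m ps.length))
        (seqs [.push (.tok (level m ps.length)) fun _ => .close, addVec p])]

/-- A bound on the running time of `search`, where `n` is the number of rounds of each loop. -/
def searchTime (n : ℕ) : List (List T) → ℕ
  | [] => 12 * Fintype.card T + 6
  | p :: ps => searchTime n ps + (n * (searchTime n ps + 6 * p.length + 6) + 2) +
      (n * (6 * p.length + 6) + 2) + 1

theorem runs_search (n : ℕ) (ps : List (List T)) (hps : ps.length ≤ m) (s : Reg Q N')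
    (t u : Fin (m + 1) → ℕ)
    (h : ∀ i < ps.length, t (level m i) = n ∧ u (level m i) = 0) (z : T → ℤ) :
    ∃ ok', (ok' = true ↔ s.ok = true ∨ InSpan n ps z) ∧
      Runs (search ps : DProg T m Q N' ι) (s, stk w z t u)
        ({ s with sym := none, eq := false, ok := ok' }, stk w z t u) (searchTime n ps) := by
  induction ps generalizing s t u z with
  | nil =>
    obtain ⟨b, hb, hR⟩ := runs_testZero (w := w) (z := z) (t := t) (u := u) (ι := ι) s
    exact ⟨b, hb, hR.mono (by simp [searchTime])⟩
  | cons p ps ih =>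
    set j := level m ps.length with hj
    simp only [List.length_cons] at hps h
    have hP : ∀ (z : T → ℤ) (a b : ℕ) (s : Reg Q N'),
        ∃ ok', (ok' = true ↔ s.ok = true ∨ InSpan n ps z) ∧
        Runs (search ps : DProg T m Q N' ι)
          (s, stk w z (Function.update t j a) (Function.update u j b))
          ({ s with sym := none, eq := false, ok := ok' },
            stk w z (Function.update t j a) (Function.update u j b)) (searchTime n ps) := by
      intro z a b s
      refine ih (by omega) s _ _ (fun i hi => ?_) z
      have hne := level_ne (m := m) hi (by omega)
      rw [Function.update_of_ne hne, Function.update_of_ne hne]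
      exact h i (by omega)
    obtain ⟨h1, h2⟩ := h ps.length (by omega)
    have et : Function.update t j n = t := by rw [← h1, Function.update_eq_self]
    have eu : Function.update u j 0 = u := by rw [← h2, Function.update_eq_self]
    obtain ⟨ok₁, hok₁, hR₁⟩ := ih (by omega) s t u (fun i hi => h i (by omega)) z
    obtain ⟨ok₂, hok₂, hR₂⟩ := runs_descend p hP n 0 { s with sym := none, eq := false, ok := ok₁ }
      rfl z
    have hR₃ := runs_ascend (w := w) (t := t) (u := u) (j := j) (ι := ι) p n 0
      { s with sym := none, eq := false, ok := ok₂ } (z - n • vec p)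
    rw [et, eu, zero_add] at hR₂
    rw [eu, zero_add, sub_add_cancel, et] at hR₃
    refine ⟨ok₂, ?_, .seqs_cons hR₁ (.seqs_cons hR₂ (.seqs_cons hR₃ (.seqs_nil le_rfl) le_rfl)
      le_rfl) ?_⟩
    · rw [hok₂, hok₁, or_assoc]
      refine or_congr_right ⟨?_, ?_⟩
      · rintro (hz | ⟨d, -, hd, hz⟩)
        · exact ⟨0, Nat.zero_le _, by simpa using hz⟩
        · exact ⟨d, hd, hz⟩
      · rintro ⟨d, hd, hz⟩
        rcases Nat.eq_zero_or_pos d with rfl | hd'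
        · exact Or.inl (by simpa using hz)
        · exact Or.inr ⟨d, hd', hd, hz⟩
    · simp only [searchTime]
      omega

/-- Search in finitely many linear sets, each given by a base vector and a list of periods. -/
noncomputable def searchAll (F : List (List T × List (List T))) : DProg T m Q N' ι :=
  seqs (F.map fun x => seqs [subVec x.1, search x.2, addVec x.1])

/-- A bound on the running time of `searchAll`. -/
def searchAllTime (n : ℕ) : List (List T × List (List T)) → ℕ
  | [] => 1
  | x :: F => (12 * x.1.length + 5 + searchTime n x.2) + searchAllTime n F

theorem runs_searchAll (n : ℕ) (F : List (List T × List (List T)))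
    (hF : ∀ x ∈ F, x.2.length ≤ m) (s : Reg Q N') :
    ∃ s', (s'.ok = true ↔ s.ok = true ∨ ∃ x ∈ F, InSpan n x.2 (z - vec x.1)) ∧
      Runs (searchAll F : DProg T m Q N' ι) (s, stk w z (fun _ => n) fun _ => 0)
        (s', stk w z (fun _ => n) fun _ => 0) (searchAllTime n F) := by
  induction F generalizing s with
  | nil => exact ⟨s, by simp, .seqs_nil le_rfl⟩
  | cons x F ih =>
    obtain ⟨ok₁, hok₁, hR₁⟩ := runs_search (w := w) (ι := ι) n x.2 (hF x List.mem_cons_self)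
      { s with sym := none } (fun _ => n) (fun _ => 0) (fun _ _ => ⟨rfl, rfl⟩) (z - vec x.1)
    obtain ⟨s₂, hs₂, hR₂⟩ := ih (fun y hy => hF y (List.mem_cons_of_mem _ hy))
      { s with sym := none, eq := false, ok := ok₁ }
    have hR := runs_addVec (m := m) (w := w) (z := z - vec x.1) (t := fun _ => n) (u := fun _ => 0) (ι := ι)
      x.1 { s with sym := none, eq := false, ok := ok₁ }
    rw [sub_add_cancel] at hR
    refine ⟨s₂, ?_, .seqs_cons (.seqs_cons (runs_subVec _ _) (.seqs_cons hR₁ (.seqs_cons hR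
      (.seqs_nil le_rfl) le_rfl) le_rfl) le_rfl) hR₂ ?_⟩
    · rw [hs₂, hok₁, or_assoc]
      simp
    · simp only [searchAllTime]
      omega

theorem exists_searchTime_le {T : Type} [Fintype T] (ps : List (List T)) :
    ∃ c d, ∀ n, searchTime n ps ≤ c * (n + 1) ^ d := by
  induction ps with
  | nil => exact ⟨12 * Fintype.card T + 6, 0, fun n => by simp [searchTime]⟩
  | cons p ps ih =>
    obtain ⟨c, d, h⟩ := ih
    set k := 6 * p.length + 6 with hk
    refine ⟨c + 2 * k + 5, d + 1, fun n => ?_⟩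
    have hX : 1 ≤ (n + 1) ^ d := Nat.one_le_pow _ _ (by omega)
    have h1 := Nat.mul_le_mul_left (n + 1) (h n)
    have h2 := Nat.mul_le_mul_left ((2 * k + 5) * (n + 1)) hX
    calc searchTime n (p :: ps)
        = (n + 1) * searchTime n ps + 2 * (n * k) + 5 := by simp only [searchTime, hk]; ring
      _ ≤ (n + 1) * searchTime n ps + (2 * k + 5) * (n + 1) * 1 := by
          have : (2 * k + 5) * (n + 1) * 1 = 2 * (n * k) + 2 * k + 5 * n + 5 := by ring
          omega
      _ ≤ (n + 1) * (c * (n + 1) ^ d) + (2 * k + 5) * (n + 1) * (n + 1) ^ d := add_le_add h1 h2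
      _ = (c + 2 * k + 5) * (n + 1) ^ (d + 1) := by ring

theorem exists_searchAllTime_le {T : Type} [Fintype T] (F : List (List T × List (List T))) :
    ∃ c d, ∀ n, searchAllTime n F ≤ c * (n + 1) ^ d := by
  induction F with
  | nil => exact ⟨1, 0, fun n => by simp [searchAllTime]⟩
  | cons x F ih =>
    obtain ⟨c, d, h⟩ := ih
    obtain ⟨c', d', h'⟩ := exists_searchTime_le x.2
    refine ⟨12 * x.1.length + 5 + c' + c, d' + d, fun n => ?_⟩
    have h1 : 1 ≤ (n + 1) ^ (d' + d) := Nat.one_le_pow _ _ (by omega)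
    have h2 : (n + 1) ^ d' ≤ (n + 1) ^ (d' + d) := Nat.pow_le_pow_right (by omega) (by omega)
    have h3 : (n + 1) ^ d ≤ (n + 1) ^ (d' + d) := Nat.pow_le_pow_right (by omega) (by omega)
    have h4 := (h' n).trans (Nat.mul_le_mul_left c' h2)
    have h5 := (h n).trans (Nat.mul_le_mul_left c h3)
    have h6 := Nat.mul_le_mul_left (12 * x.1.length + 5) h1
    simp only [searchAllTime, add_mul] at *
    omega

end ShEx

/-! ### Reading and comparing words -/

namespace ShEx

open Prog

section Words

variable {T : Type} [DecidableEq T] {m : ℕ} {Q N' ι : Type} {w : Work} {z : T → ℤ}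
  {t u : Fin (m + 1) → ℕ}

/-- Move the contents of a stack to another one, in reverse order. -/
def moveAll (k k' : Stk T m) : DProg T m Q N' ι := forEach k (pushSym k')

theorem runs_moveAll {k k' : Stk T m} (hk : k ≠ k') (s : Reg Q N') (S : Stk T m → List Sym) :
    Runs (moveAll k k' : DProg T m Q N' ι) (s, S) ({ s with sym := none },
      Function.update (Function.update S k []) k' ((S k).reverse ++ S k')) (3 * (S k).length + 2) := by
  generalize hl : S k = l
  induction l generalizing s S with
  | nil =>
    have h : Function.update (Function.update S k []) k' (([] : List Sym).reverse ++ S k') = S := by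
      rw [List.reverse_nil, List.nil_append, ← hl, Function.update_eq_self,
        Function.update_eq_self]
    rw [h]
    exact forEach_nil hl
  | cons a l ih =>
    have h := ih { s with sym := some a } (Function.update (Function.update S k l) k' (a :: S k'))
      (by rw [Function.update_of_ne hk, Function.update_self])
    have e : Function.update (Function.update (Function.update (Function.update S k l) k'
        (a :: S k')) k []) k' (l.reverse ++
          Function.update (Function.update S k l) k' (a :: S k') k') =
        Function.update (Function.update S k []) k' ((a :: l).reverse ++ S k') := by
      funext i
      by_cases h1 : i = k'
      · subst h1; simp
      · by_cases h2 : i = k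
        · subst h2; simp [h1]
        · simp [h1, h2]
    rw [e] at h
    refine forEach_cons hl (t₁ := 1) (Straight.runs' (by simp [Straight, pushSym]) ?_
      (by simp [cost, pushSym])) h (by simp only [List.length_cons]; omega)
    simp [exec, pushSym, Function.update_of_ne hk.symm]

/-- Discard the contents of a stack. -/
def clear (k : Stk T m) : DProg T m Q N' ι := forEach k (.load id)

theorem runs_clear (k : Stk T m) (s : Reg Q N') (S : Stk T m → List Sym) :
    Runs (clear k : DProg T m Q N' ι) (s, S) ({ s with sym := none }, Function.update S k [])
      (3 * (S k).length + 2) := by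
  generalize hl : S k = l
  induction l generalizing s S with
  | nil =>
    have h : Function.update S k [] = S := by rw [← hl, Function.update_eq_self]
    rw [h]
    exact forEach_nil hl
  | cons a l ih =>
    have h := ih { s with sym := some a } (Function.update S k l) (by simp)
    rw [Function.update_idem] at h
    exact forEach_cons hl (.load _ _ _ 1 le_rfl) h (by simp only [List.length_cons]; omega)

variable (q₀ : Q) (δ : Q → Sym → Q)

/-- Move a word up to its end marker from a stack to another one, in reverse order, and run the
automaton on it. -/
def read (k k' : Stk T m) : DProg T m Q N' ι :=
  seqs [.load fun s => { s with sym := none, q := q₀ },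
    .loop (fun s => s.sym ≠ some Sym.close)
      (seqs [popSym k, pushSym k', .load fun s => { s with q := δ s.q (s.sym.getD Sym.close) }])]

theorem runs_read {k k' : Stk T m} (hk : k ≠ k') {l : List Sym} (hl : Sym.close ∉ l)
    (rest : List Sym) (s : Reg Q N') (S : Stk T m → List Sym) (hS : S k = l ++ .close :: rest) :
    Runs (read q₀ δ k k' : DProg T m Q N' ι) (s, S)
      ({ s with sym := some Sym.close, q := (l ++ [Sym.close]).foldl δ q₀ },
        Function.update (Function.update S k rest) k' (.close :: l.reverse ++ S k'))
      (5 * l.length + 9) := by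
  refine .seqs_cons (.load _ _ _ 1 le_rfl) (.seqs_cons (t₁ := 5 * l.length + 6) ?_
    (.seqs_nil le_rfl) le_rfl) (by omega)
  have key : ∀ (q : Q) (y : Option Sym) (_ : y ≠ some Sym.close),
      Runs (.loop (fun s => s.sym ≠ some Sym.close)
        (seqs [popSym k, pushSym k', .load fun s => { s with q := δ s.q (s.sym.getD Sym.close) }]) :
          DProg T m Q N' ι) ({ s with sym := y, q := q }, S)
        ({ s with sym := some Sym.close, q := (l ++ [Sym.close]).foldl δ q },
          Function.update (Function.update S k rest) k' (.close :: l.reverse ++ S k'))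
        (5 * l.length + 6) := by
    induction l generalizing S with
    | nil =>
      intro q y hy
      refine .loop_true (t₁ := 4) (t₂ := 1) (by simpa using hy) (Straight.runs'
        (by simp [Straight, popSym, pushSym]) ?_ (by simp [cost, popSym, pushSym]))
        (.loop_false (by simp) le_rfl) (by simp)
      simp [exec, popSym, pushSym, hS, Function.update_of_ne hk.symm]
    | cons a l ih =>
      intro q y hy
      rw [List.mem_cons, not_or] at hl
      have h := ih hl.2 (Function.update (Function.update S k (l ++ .close :: rest)) k' (a :: S k'))
        (by rw [Function.update_of_ne hk, Function.update_self]) (δ q a) (some a)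
        (by simpa using Ne.symm hl.1)
      refine .loop_true (t₁ := 4) (by simpa using hy) (Straight.runs'
        (by simp [Straight, popSym, pushSym]) rfl (by simp [cost, popSym, pushSym]))
        (t₂ := 5 * l.length + 6) ?_ (by simp only [List.length_cons]; omega)
      convert h using 1
      · simp [exec, popSym, pushSym, hS, Function.update_of_ne hk.symm]
      · congr 1
        funext i
        by_cases h1 : i = k'
        · subst h1; simp
        · by_cases h2 : i = k
          · subst h2; simp [h1]
          · simp [h1, h2]
  exact key q₀ none (by simp)

/-- Move a word up to its end marker from `inp` to `done`, and compare it with the word whose first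
part is in `tmp`, in reverse order, and whose second part is in `reg`. -/
def compare : DProg T m Q N' ι :=
  seqs [moveAll .tmp .reg, .load fun s => { s with sym := none, eq := true },
    .loop (fun s => s.sym ≠ some Sym.close)
      (seqs [popSym .inp, pushSym .done, .pop .reg fun s a => { s with aux := a },
        .load fun s => { s with eq := s.eq && decide (s.sym = s.aux) },
        .ite (fun s => s.aux.isSome) (.push .tmp fun s => s.aux.getD Sym.close) (.load id)])]

/-- Since the end marker occurs at the end only, the comparison of the words may stop at the end of the
first one. -/
theorem isPrefix_close_iff {l l' : List Sym} (hl' : Sym.close ∉ l') :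
    l ++ [.close] <+: l' ++ [.close] ↔ l = l' := by
  constructor
  · rintro ⟨r, hr⟩
    rcases List.eq_nil_or_concat r with rfl | ⟨r', a, rfl⟩
    · simpa using hr
    · rw [List.concat_eq_append, ← List.append_assoc] at hr
      have := (List.append_inj' hr rfl).1
      exact absurd (this ▸ (by simp : Sym.close ∈ l ++ [.close] ++ r')) hl'
  · rintro rfl
    exact List.prefix_rfl

/-- The two parts of the second word move between `tmp` and `reg`, but together they still make up this
word, so that it can be compared with another word afterwards. -/
theorem runs_compare {l l' : List Sym} (hl : Sym.close ∉ l) (hl' : Sym.close ∉ l')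
    (rest : List Sym) (s : Reg Q N') (hinp : w.inp = l ++ .close :: rest)
    (hreg : w.tmp.reverse ++ w.reg = l' ++ [.close]) :
    ∃ a b x y, (b = true ↔ l = l') ∧ y.reverse ++ x = l' ++ [.close] ∧
      Runs (compare : DProg T m Q N' ι) (s, stk w z t u)
        ({ s with sym := some Sym.close, aux := a, eq := b },
          stk { w with inp := rest, reg := x, tmp := y, done := .close :: l.reverse ++ w.done } z t u)
        (3 * l'.length + 9 * l.length + 20) := by
  have key : ∀ (w : Work) (s : Reg Q N'), s.sym ≠ some Sym.close → w.inp = l ++ .close :: rest →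
      ∃ a b x y, (b = true ↔ s.eq = true ∧ l ++ [.close] <+: w.reg) ∧
        y.reverse ++ x = w.tmp.reverse ++ w.reg ∧
        Runs (.loop (fun s => s.sym ≠ some Sym.close)
            (seqs [popSym .inp, pushSym .done, .pop .reg fun s a => { s with aux := a },
              .load fun s => { s with eq := s.eq && decide (s.sym = s.aux) },
              .ite (fun s => s.aux.isSome) (.push .tmp fun s => s.aux.getD Sym.close) (.load id)]) :
            DProg T m Q N' ι) (s, stk w z t u)
          ({ s with sym := some Sym.close, aux := a, eq := b },
            stk { w with inp := rest, reg := x, tmp := y, done := .close :: l.reverse ++ w.done }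
              z t u) (9 * l.length + 10) := by
    clear hinp hreg
    induction l with
    | nil =>
      intro w s hs hinp
      cases hx : w.reg with
      | nil =>
        refine ⟨none, false, [], w.tmp, by simp, rfl, .loop_true (t₁ := 8) (t₂ := 1)
          (by simpa using hs) (Straight.runs' (by simp [Straight, popSym, pushSym]) ?_
            (by simp [cost, popSym, pushSym])) (.loop_false (by simp) le_rfl) (by simp)⟩
        simp [exec, popSym, pushSym, stk, hinp, hx]
      | cons c x =>
        refine ⟨some c, s.eq && decide (Sym.close = c), x, c :: w.tmp, by simp [List.cons_prefix_cons], by simp,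
          .loop_true (t₁ := 8) (t₂ := 1)
          (by simpa using hs) (Straight.runs' (by simp [Straight, popSym, pushSym]) ?_
            (by simp [cost, popSym, pushSym])) (.loop_false (by simp) le_rfl) (by simp)⟩
        simp [exec, popSym, pushSym, stk, hinp, hx]
    | cons c l ih =>
      intro w s hs hinp
      rw [List.mem_cons, not_or] at hl
      cases hx : w.reg with
      | nil =>
        obtain ⟨a, b, x, y, hb, hxy, hR⟩ := ih hl.2
          { w with inp := l ++ .close :: rest, done := c :: w.done }
          { s with sym := some c, aux := none, eq := false } (by simpa using Ne.symm hl.1) rfl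
        refine ⟨a, b, x, y, ?_, ?_, .loop_true (t₁ := 8) (by simpa using hs) (Straight.runs'
          (by simp [Straight, popSym, pushSym]) rfl (by simp [cost, popSym, pushSym]))
          (t₂ := 9 * l.length + 10) ?_ (by simp only [List.length_cons]; omega)⟩
        · simp [hb]
        · simp [hxy, hx]
        · convert hR using 1
          · simp [exec, popSym, pushSym, stk, hinp, hx]
          · simp
      | cons d x₀ =>
        obtain ⟨a, b, x, y, hb, hxy, hR⟩ := ih hl.2
          { w with inp := l ++ .close :: rest, done := c :: w.done, reg := x₀, tmp := d :: w.tmp }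
          { s with sym := some c, aux := some d, eq := s.eq && decide (c = d) }
          (by simpa using Ne.symm hl.1) rfl
        refine ⟨a, b, x, y, ?_, ?_, .loop_true (t₁ := 8) (by simpa using hs) (Straight.runs'
          (by simp [Straight, popSym, pushSym]) rfl (by simp [cost, popSym, pushSym]))
          (t₂ := 9 * l.length + 10) ?_ (by simp only [List.length_cons]; omega)⟩
        · simp [hb, List.cons_prefix_cons, and_assoc]
        · simp [hxy]
        · convert hR using 1
          · simp [exec, popSym, pushSym, stk, hinp, hx]
          · simp
  have hmove := runs_moveAll (ι := ι) (k := (.tmp : Stk T m)) (k' := .reg) (by simp) s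
    (stk w z t u)
  have hlen : w.tmp.length ≤ l'.length + 1 := by
    have := congrArg List.length hreg
    simp at this
    omega
  obtain ⟨a, b, x, y, hb, hxy, hR⟩ := key { w with tmp := [], reg := l' ++ [.close] }
    { s with sym := none, eq := true } (by simp) hinp
  refine ⟨a, b, x, y, ?_, by simpa using hxy, .seqs_cons hmove (.seqs_cons (.load _ _ _ 1 le_rfl)
    (.seqs_cons (t₁ := 9 * l.length + 10) ?_ (.seqs_nil le_rfl) le_rfl) le_rfl) ?_⟩
  · rw [hb, ← isPrefix_close_iff hl']
    simp
  · simpa [stk, hreg] using hR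
  · simp only [stk]
    omega

/-- Move the symbols before the first tag `pair` from `inp` to `done`, in reverse order. -/
def split : DProg T m Q N' ι :=
  seqs [popSym .inp, .loop (fun s => s.sym.isSome && s.sym ≠ some Sym.pair)
      (seqs [pushSym .done, popSym .inp]),
    .ite (fun s => s.sym.isSome) (pushSym .inp) (.load id)]

theorem runs_split {l rest : List Sym} (hl : Sym.pair ∉ l)
    (hrest : rest = [] ∨ ∃ r, rest = .pair :: r) (s : Reg Q N') (hinp : w.inp = l ++ rest) :
    ∃ y, Runs (split : DProg T m Q N' ι) (s, stk w z t u) ({ s with sym := y },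
      stk { w with inp := rest, done := l.reverse ++ w.done } z t u) (4 * l.length + 6) := by
  have key : ∀ (w : Work) (s : Reg Q N'), s.sym = (l ++ rest).head? → w.inp = (l ++ rest).tail →
      Runs (.loop (fun s => s.sym.isSome && s.sym ≠ some Sym.pair) (seqs [pushSym .done, popSym .inp]) :
          DProg T m Q N' ι) (s, stk w z t u)
        ({ s with sym := rest.head? },
          stk { w with inp := rest.tail, done := l.reverse ++ w.done } z t u)
        (4 * l.length + 1) := by
    clear hinp
    induction l with
    | nil =>
      intro w s hs hinp
      simp only [List.nil_append] at hs hinp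
      rw [← hs, ← hinp]
      refine .loop_false ?_ (by simp)
      rcases hrest with rfl | ⟨r, rfl⟩ <;> simp [hs]
    | cons a l ih =>
      intro w s hs hinp
      simp only [List.cons_append, List.head?_cons, List.tail_cons] at hs hinp
      rw [List.mem_cons, not_or] at hl
      have h := ih hl.2 { w with inp := (l ++ rest).tail, done := a :: w.done }
        { s with sym := (l ++ rest).head? } rfl rfl
      refine .loop_true (t₁ := 3) (by simp [hs, Ne.symm hl.1]) (Straight.runs'
        (by simp [Straight, popSym, pushSym]) rfl (by simp [cost, popSym, pushSym]))
        (t₂ := 4 * l.length + 1) ?_ (by simp only [List.length_cons]; omega)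
      convert h using 1
      · simp [exec, popSym, pushSym, stk, hinp, hs]
      · simp
  have h := key { w with inp := (l ++ rest).tail } { s with sym := (l ++ rest).head? } rfl rfl
  refine ⟨rest.head?, .seqs_cons (t₁ := 1) (b := ({ s with sym := (l ++ rest).head? },
    stk { w with inp := (l ++ rest).tail } z t u)) ?_ (.seqs_cons h (.seqs_cons (t₁ := 3)
      (Straight.runs' (by simp [Straight, pushSym]) ?_ (by simp [cost, pushSym]))
      (.seqs_nil (t := 1) le_rfl) le_rfl) le_rfl) (by omega)⟩
  · have := Runs.pop (ι := ι) (.inp : Stk T m) (fun (s : Reg Q N') a => { s with sym := a }) s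
      (stk w z t u) 1 le_rfl
    simpa [popSym, stk, hinp] using this
  · rcases hrest with rfl | ⟨r, rfl⟩ <;> simp [exec, pushSym, stk]

end Words

end ShEx

/-! ### Looking up a term -/

namespace ShEx

open Prog

variable {I L B N : Type}

theorem encodeWord_injective : Function.Injective encodeWord := fun w w' h => by
  have h' := (List.append_inj' h rfl).1
  exact List.map_injective_iff.2 (fun a b hab => by injection hab) h'

theorem close_notMem_map_bit (w : List Bool) : Sym.close ∉ w.map Sym.bit := by simp

theorem pair_notMem_encodeWord (w : List Bool) : Sym.pair ∉ encodeWord w := by simp [encodeWord]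

theorem encodeTerm_injective (κ : Coding I L B N) : Function.Injective (encodeTerm κ) := by
  intro t u h
  cases t <;> cases u <;> simp only [encodeTerm, List.cons.injEq, reduceCtorEq, false_and,
    true_and] at h
  · rw [κ.iri_injective (encodeWord_injective h)]
  · rw [κ.lit_injective (encodeWord_injective h)]
  · rw [κ.blank_injective (encodeWord_injective h)]

/-- The end marker occurs in the code of a term at its end only. -/
theorem exists_encodeTerm_eq (κ : Coding I L B N) (t : Term I L B) :
    ∃ l, Sym.close ∉ l ∧ encodeTerm κ t = l ++ [Sym.close] := by
  cases t with
  | iri i => exact ⟨Sym.iri :: (κ.iri i).map Sym.bit, by simp, rfl⟩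
  | lit i => exact ⟨Sym.lit :: (κ.lit i).map Sym.bit, by simp, rfl⟩
  | blank i => exact ⟨Sym.blank :: (κ.blank i).map Sym.bit, by simp, rfl⟩

theorem pair_notMem_encodeTerm (κ : Coding I L B N) (t : Term I L B) :
    Sym.pair ∉ encodeTerm κ t := by
  cases t <;> simp [encodeTerm, pair_notMem_encodeWord]

theorem pair_notMem_encodeTriple (κ : Coding I L B N) (t : Triple I L B) :
    Sym.pair ∉ encodeTriple κ t := by
  simp [encodeTriple, pair_notMem_encodeTerm, pair_notMem_encodeWord]

/-- The registers that hold results for the current triple are unchanged. -/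
structure Reg.Keeps {Q N' : Type} (s s' : Reg Q N') : Prop where
  pred : s'.pred = s.pred
  srcNames : s'.srcNames = s.srcNames
  srcIsNode : s'.srcIsNode = s.srcIsNode
  ok : s'.ok = s.ok

variable {T : Type} [DecidableEq T] {m : ℕ} {Q N' ι : Type} {w : Work} {z : T → ℤ}
  {t u : Fin (m + 1) → ℕ} {q₀ : Q} {δ : Q → Sym → Q} {nameOf : Q → Option N'} {κ : Coding I L B N}

theorem runs_compare_term {v v' : Term I L B} (rest : List Sym) (s : Reg Q N')
    (hinp : w.inp = encodeTerm κ v ++ rest) (hreg : w.tmp.reverse ++ w.reg = encodeTerm κ v') :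
    ∃ a b x y, (b = true ↔ v = v') ∧ y.reverse ++ x = encodeTerm κ v' ∧
      Runs (compare : DProg T m Q N' ι) (s, stk w z t u)
        ({ s with sym := some .close, aux := a, eq := b },
          stk { w with
            inp := rest, reg := x, tmp := y, done := (encodeTerm κ v).reverse ++ w.done } z t u)
        (3 * (encodeTerm κ v').length + 9 * (encodeTerm κ v).length + 11) := by
  obtain ⟨l, hl, e⟩ := exists_encodeTerm_eq κ v
  obtain ⟨l', hl', e'⟩ := exists_encodeTerm_eq κ v'
  obtain ⟨a, b, x, y, hb, hxy, hR⟩ := runs_compare (z := z) (t := t) (u := u) (ι := ι) hl hl' rest s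
    (by simpa [e] using hinp) (by rw [hreg, e'])
  refine ⟨a, b, x, y, ?_, by rw [hxy, e'], ?_⟩
  · rw [hb, ← (encodeTerm_injective κ).eq_iff, e, e']
    simp
  · have h := hR.mono (t' := 3 * (encodeTerm κ v').length + 9 * (encodeTerm κ v).length + 11)
      (by simp only [e, e', List.length_append, List.length_singleton]; omega)
    simpa [e] using h

variable [DecidableEq N']

/-- The result of the automaton on a word. -/
def runWord (q₀ : Q) (δ : Q → Sym → Q) (l : List Bool) : Q := (encodeWord l).foldl δ q₀

/-- The relevant names that a list of pairs assigns to a term. The function `nm` singles out the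
relevant names and is `none` on the other ones. -/
noncomputable def labels [Fintype N'] (nm : N → Option N') (pairs : List (N × Term I L B))
    (v : Term I L B) : Finset N' :=
  open Classical in {n | ∃ y ∈ pairs, y.2 = v ∧ nm y.1 = some n}

/-- Add an optional element to a finite set. -/
def insertOption (o : Option N') (A : Finset N') : Finset N' := o.elim A fun n => insert n A

theorem mem_insertOption {o : Option N'} {A : Finset N'} {n : N'} :
    n ∈ insertOption o A ↔ n ∈ A ∨ o = some n := by
  cases o <;> simp [insertOption, or_comm, eq_comm]

/-- Compare the term that is looked up with the term of the first pair in `inp`. If they agree, add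
the name of the pair to `names`. -/
def scanPair (q₀ : Q) (δ : Q → Sym → Q) (nameOf : Q → Option N') : DProg T m Q N' ι :=
  seqs [pushSym .done, read q₀ δ .inp .done, compare,
    .load fun s => if s.eq then { s with names := insertOption (nameOf s.q) s.names } else s]

/-- Compute the names that are assigned to the term in `tmp` and `reg`, and whether it is the node
of the input. -/
def lookup (q₀ : Q) (δ : Q → Sym → Q) (nameOf : Q → Option N') : DProg T m Q N' ι :=
  seqs [compare, .load fun s => { s with names := ∅, isNode := s.eq },
    forEach .inp (scanPair q₀ δ nameOf), moveAll .done .inp]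

theorem runs_scanPairs (pairs : List (N × Term I L B)) (v : Term I L B) (w : Work) (s : Reg Q N')
    (hinp : w.inp = pairs.flatMap (encodePair κ))
    (hreg : w.tmp.reverse ++ w.reg = encodeTerm κ v) :
    ∃ s' x y, y.reverse ++ x = encodeTerm κ v ∧
      (∀ n, n ∈ s'.names ↔ n ∈ s.names ∨
        ∃ p ∈ pairs, p.2 = v ∧ nameOf (runWord q₀ δ (κ.name p.1)) = some n) ∧
      s'.isNode = s.isNode ∧ s.Keeps s' ∧
      Runs (forEach .inp (scanPair q₀ δ nameOf) : DProg T m Q N' ι) (s, stk w z t u)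
        (s', stk { w with inp := [], reg := x, tmp := y, done := w.inp.reverse ++ w.done } z t u)
        ((3 * (encodeTerm κ v).length + 40) * w.inp.length + 2) := by
  induction pairs generalizing w s with
  | nil =>
    simp only [List.flatMap_nil] at hinp
    refine ⟨{ s with sym := none }, w.reg, w.tmp, hreg, by simp, rfl, ⟨rfl, rfl, rfl, rfl⟩, ?_⟩
    have h := forEach_nil (k := (.inp : Stk T m)) (P := scanPair q₀ δ nameOf) (ι := ι) (s := s)
      (S := stk w z t u) (by simpa [stk] using hinp)
    convert h.mono (Nat.le_add_left _ _) using 3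
    cases w
    simp_all
  | cons p pairs ih =>
    set R := pairs.flatMap (encodePair κ) with hR
    have hinp' : w.inp = .pair :: ((κ.name p.1).map Sym.bit ++
        .close :: (encodeTerm κ p.2 ++ R)) := by
      rw [hinp, List.flatMap_cons]
      simp [encodePair, encodeWord, ← hR]
    have h1 := runs_read (ι := ι) q₀ δ (k := (.inp : Stk T m)) (k' := .done) (by simp)
      (close_notMem_map_bit (κ.name p.1)) (encodeTerm κ p.2 ++ R) { s with sym := some .pair }
      (stk { w with
        inp := (κ.name p.1).map Sym.bit ++ .close :: (encodeTerm κ p.2 ++ R),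
        done := .pair :: w.done } z t u) rfl
    simp only [update_inp, update_done] at h1
    obtain ⟨a, b, x₁, y₁, hb, hxy₁, h2⟩ := runs_compare_term (κ := κ) (v := p.2) (v' := v) (ι := ι)
      (m := m) (z := z) (t := t) (u := u)
      (w := { w with
        inp := encodeTerm κ p.2 ++ R,
        done := .close :: ((κ.name p.1).map Sym.bit).reverse ++ .pair :: w.done }) R
      { s with sym := some .close, q := runWord q₀ δ (κ.name p.1) } rfl hreg
    set s₁ : Reg Q N' := { s with sym := some .close, q := runWord q₀ δ (κ.name p.1), aux := a, eq := b }
      with hs₁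
    set s₂ : Reg Q N' := if s₁.eq then
      { s₁ with names := insertOption (nameOf s₁.q) s₁.names } else s₁ with hs₂
    have hkeep : s.Keeps s₂ ∧ s₂.isNode = s.isNode ∧ ∀ n, n ∈ s₂.names ↔
        n ∈ s.names ∨ (p.2 = v ∧ nameOf (runWord q₀ δ (κ.name p.1)) = some n) := by
      rw [hs₂, ← hb]
      cases b with
      | false => exact ⟨⟨rfl, rfl, rfl, rfl⟩, rfl, fun n => by simp [hs₁]⟩
      | true =>
        refine ⟨⟨rfl, rfl, rfl, rfl⟩, rfl, fun n => ?_⟩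
        simp only [hs₁, if_true, true_and]
        exact mem_insertOption
    obtain ⟨hk, hnode, hnames⟩ := hkeep
    obtain ⟨s₃, x, y, hxy, hnames', hnode', hk', h3⟩ := ih
      { w with inp := R, reg := x₁, tmp := y₁, done := (encodePair κ p).reverse ++ w.done } s₂ rfl
      hxy₁
    have hinp'' : w.inp = encodePair κ p ++ R := hinp
    refine ⟨s₃, x, y, hxy, fun n => ?_, hnode'.trans hnode, ⟨hk'.pred.trans hk.pred,
      hk'.srcNames.trans hk.srcNames, hk'.srcIsNode.trans hk.srcIsNode, hk'.ok.trans hk.ok⟩, ?_⟩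
    · rw [hnames', hnames]
      simp [or_assoc]
    · refine forEach_cons (S := stk w z t u) (k := .inp) hinp'
        (t₁ := 3 * (encodeTerm κ v).length + 9 * (encodePair κ p).length + 22)
        (b := (s₂, stk { w with
          inp := R, reg := x₁, tmp := y₁, done := (encodePair κ p).reverse ++ w.done } z t u)) ?_
        (by simpa [hinp''] using h3) ?_
      · rw [update_inp]
        refine .seqs_cons (t₁ := 1) (Straight.runs' (by simp [Straight, pushSym]) rfl
          (by simp [cost, pushSym])) (.seqs_cons (by simpa [exec, pushSym, stk] using h1)
            (.seqs_cons (by simpa [runWord, encodeWord, stk] using h2)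
              (.seqs_cons (t₁ := 1) (Straight.runs' (by simp [Straight]) ?_ (by simp [cost]))
                (.seqs_nil (t := 1) le_rfl) le_rfl) le_rfl) le_rfl) ?_
        · simp [exec, hs₂, encodePair, encodeWord]
        · simp [encodePair, encodeWord]
          omega
      · have h1 : 1 ≤ (encodePair κ p).length := by simp [encodePair]
        have h2 := Nat.mul_le_mul_left (3 * (encodeTerm κ v).length + 31) h1
        simp only [hinp'', List.length_append]
        nlinarith

/-- Looking up a term leaves `inp` unchanged, and takes time quadratic in the length of the input: the
term is compared with the one in each pair. -/
theorem runs_lookup [Fintype N'] (node v : Term I L B) (pairs : List (N × Term I L B)) (w : Work)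
    (s : Reg Q N') (hinp : w.inp = encodeTerm κ node ++ pairs.flatMap (encodePair κ))
    (hdone : w.done = []) (hreg : w.tmp.reverse ++ w.reg = encodeTerm κ v) :
    ∃ s' x y, y.reverse ++ x = encodeTerm κ v ∧
      s'.names = labels (fun n => nameOf (runWord q₀ δ (κ.name n))) pairs v ∧
      (s'.isNode = true ↔ node = v) ∧ s.Keeps s' ∧
      Runs (lookup q₀ δ nameOf : DProg T m Q N' ι) (s, stk w z t u)
        (s', stk { w with reg := x, tmp := y } z t u)
        ((3 * (encodeTerm κ v).length + 60) * (w.inp.length + 1)) := by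
  obtain ⟨a, b, x₁, y₁, hb, hxy₁, h1⟩ := runs_compare_term (z := z) (t := t) (u := u) (ι := ι) _ s
    hinp hreg
  obtain ⟨s₂, x, y, hxy, hnames, hnode, hk, h2⟩ := runs_scanPairs (z := z) (t := t) (u := u) (ι := ι)
    (q₀ := q₀) (δ := δ) (nameOf := nameOf) pairs v
    { w with
      inp := pairs.flatMap (encodePair κ), reg := x₁, tmp := y₁,
      done := (encodeTerm κ node).reverse ++ w.done }
    { s with sym := some .close, aux := a, eq := b, names := ∅, isNode := b } rfl hxy₁
  have h3 := runs_moveAll (ι := ι) (k := (.done : Stk T m)) (k' := .inp) (by simp) s₂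
    (stk { w with
      inp := [], reg := x, tmp := y,
      done := (pairs.flatMap (encodePair κ)).reverse ++ ((encodeTerm κ node).reverse ++ w.done) }
      z t u)
  have e : stk { w with reg := x, tmp := y } z t u =
      Function.update (Function.update (stk { w with
        inp := [], reg := x, tmp := y,
        done := (pairs.flatMap (encodePair κ)).reverse ++ ((encodeTerm κ node).reverse ++ w.done) }
        z t u) .done []) .inp ((stk { w with
        inp := [], reg := x, tmp := y,
        done := (pairs.flatMap (encodePair κ)).reverse ++ ((encodeTerm κ node).reverse ++ w.done) }
        z t u .done).reverse ++ stk { w with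
        inp := [], reg := x, tmp := y,
        done := (pairs.flatMap (encodePair κ)).reverse ++ ((encodeTerm κ node).reverse ++ w.done) }
        z t u .inp) := by
    obtain ⟨inp, tri, reg, tmp, done⟩ := w
    simp only at hinp hdone
    subst hinp hdone
    simp [stk]
  refine ⟨{ s₂ with sym := none }, x, y, hxy, ?_, ?_, ⟨hk.pred, hk.srcNames, hk.srcIsNode, hk.ok⟩, ?_⟩
  · ext n
    simp [hnames, labels]
  · exact (iff_of_eq (congrArg (· = true) hnode)).trans hb
  · rw [e]
    refine .seqs_cons h1 (.seqs_cons (.load _ _ _ 1 le_rfl) (.seqs_cons h2 (.seqs_cons h3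
      (.seqs_nil (t := 1) le_rfl) le_rfl) le_rfl) le_rfl) ?_
    simp only [stk, hinp, hdone, List.length_append, List.length_reverse, List.length_nil]
    nlinarith [Nat.zero_le ((encodeTerm κ v).length * (encodeTerm κ node).length)]

end ShEx

/-! ### Counting the edges at the input node by type -/

namespace ShEx

open Prog

section Neighbourhood

variable {I L B : Type}

open Classical in
/-- The edges and inverse edges with source `v` that come from a triple. -/
noncomputable def Triple.edgesAt (v : Term I L B) (tr : Triple I L B) : List (Edge I L B) :=
  (if v = tr.source then [tr.edge] else []) ++ if v = tr.obj then [tr.invEdge] else []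

theorem Triple.mem_edgesAt {v : Term I L B} {tr : Triple I L B} {x : Edge I L B} :
    x ∈ tr.edgesAt v ↔ (x = tr.edge ∨ x = tr.invEdge) ∧ x.src = v := by
  by_cases h1 : v = tr.source <;> by_cases h2 : v = tr.obj <;>
    simp only [edgesAt, h1, h2, if_true, if_false, List.mem_append, List.mem_singleton,
      List.not_mem_nil, or_false] <;>
    constructor <;> (try rintro (rfl | rfl)) <;> (try rintro ⟨rfl | rfl, h⟩) <;>
    simp_all [Triple.edge, Triple.invEdge]

theorem Triple.edge_injective :
    Function.Injective (Triple.edge : Triple I L B → Edge I L B) := by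
  rintro ⟨a, p, b⟩ ⟨a', p', b'⟩ h
  cases a <;> cases a' <;> simp_all [Triple.edge, Triple.source]

theorem Triple.invEdge_injective :
    Function.Injective (Triple.invEdge : Triple I L B → Edge I L B) := by
  rintro ⟨a, p, b⟩ ⟨a', p', b'⟩ h
  cases a <;> cases a' <;> simp_all [Triple.invEdge, Triple.source]

theorem Triple.edge_ne_invEdge (tr tr' : Triple I L B) : tr.edge ≠ tr'.invEdge := by
  simp [Triple.edge, Triple.invEdge]

theorem Triple.nodup_edgesAt (v : Term I L B) (tr : Triple I L B) : (tr.edgesAt v).Nodup := by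
  unfold edgesAt
  split_ifs <;> simp [Triple.edge_ne_invEdge]

theorem Triple.nodup_flatMap_edgesAt {trs : List (Triple I L B)} (h : trs.Nodup) (v : Term I L B) :
    (trs.flatMap (Triple.edgesAt v)).Nodup := by
  rw [List.nodup_flatMap]
  refine ⟨fun tr _ => tr.nodup_edgesAt v, h.imp fun {tr tr'} hne => ?_⟩
  intro x hx hx'
  rw [Triple.mem_edgesAt] at hx hx'
  rcases hx.1 with rfl | rfl <;> rcases hx'.1 with h | h
  · exact hne (Triple.edge_injective h)
  · exact Triple.edge_ne_invEdge _ _ h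
  · exact Triple.edge_ne_invEdge _ _ h.symm
  · exact hne (Triple.invEdge_injective h)

theorem Triple.length_edgesAt_le (v : Term I L B) (tr : Triple I L B) :
    (tr.edgesAt v).length ≤ 2 := by
  unfold edgesAt
  split_ifs <;> simp

/-- The type count of the set of members of a list without repetition. -/
theorem typeCount_eq_count {E T : Type} [DecidableEq T] {ty : E → T} {l : List E} (h : l.Nodup)
    (τ : T) : typeCount ty {x | x ∈ l} τ = (l.map ty).count τ := by
  classical
  have : {x | x ∈ l} ∩ ty ⁻¹' {τ} = ((l.filter fun x => ty x == τ).toFinset : Set E) := by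
    ext x; simp
  rw [typeCount, this, Set.ncard_coe_finset, List.toFinset_card_of_nodup (h.filter _),
    List.count, List.countP_map, List.countP_eq_length_filter]
  rfl

theorem Graph.neigh_eq {trs : List (Triple I L B)} (h : trs.Nodup) (v : Term I L B) :
    Graph.neigh (⟨trs, h⟩ : Graph I L B) v = {x | x ∈ trs.flatMap (Triple.edgesAt v)} := by
  ext x
  simp only [Graph.neigh, Graph.edges, Set.mem_ofPred_eq, List.mem_flatMap, Triple.mem_edgesAt,
    ← Finset.mem_val, Multiset.mem_coe]
  exact ⟨fun ⟨⟨tr, htr, hx⟩, hv⟩ => ⟨tr, htr, hx, hv⟩, fun ⟨tr, htr, hx, hv⟩ => ⟨⟨tr, htr, hx⟩, hv⟩⟩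

end Neighbourhood

variable {I L B N : Type} {P' N' Q : Type} {m : ℕ} {w : Work} {q₀ : Q} {δ : Q → Sym → Q}
  {nameOf : Q → Option N'} {predOf : Q → P'} {κ : Coding I L B N}

theorem runs_read_term {T ι : Type} [DecidableEq T] {k k' : Stk T m} (hk : k ≠ k')
    (v : Term I L B) (rest : List Sym) (s : Reg Q N') (S : Stk T m → List Sym)
    (hS : S k = encodeTerm κ v ++ rest) :
    ∃ q, Runs (read q₀ δ k k' : DProg T m Q N' ι) (s, S)
      ({ s with sym := some .close, q := q },
        Function.update (Function.update S k rest) k' ((encodeTerm κ v).reverse ++ S k'))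
      (5 * (encodeTerm κ v).length + 9) := by
  obtain ⟨l, hl, e⟩ := exists_encodeTerm_eq κ v
  have h := runs_read (ι := ι) q₀ δ hk hl rest s S (by simpa [e] using hS)
  refine ⟨(l ++ [Sym.close]).foldl δ q₀, ?_⟩
  rw [e]
  simpa using h.mono (t' := 5 * (l ++ [Sym.close]).length + 9)
    (by simp only [List.length_append]; omega)

theorem runs_read_word {T ι : Type} [DecidableEq T] {k k' : Stk T m} (hk : k ≠ k')
    (l : List Bool) (rest : List Sym) (s : Reg Q N') (S : Stk T m → List Sym)
    (hS : S k = encodeWord l ++ rest) :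
    Runs (read q₀ δ k k' : DProg T m Q N' ι) (s, S)
      ({ s with sym := some .close, q := runWord q₀ δ l },
        Function.update (Function.update S k rest) k' ((encodeWord l).reverse ++ S k'))
      (5 * (encodeWord l).length + 9) := by
  have h := runs_read (ι := ι) q₀ δ hk (close_notMem_map_bit l) rest s S
    (by simpa [encodeWord] using hS)
  simpa [encodeWord, runWord] using h.mono (t' := 5 * (encodeWord l).length + 9)
    (by simp only [encodeWord, List.length_append]; omega)

variable [DecidableEq P'] [DecidableEq N']

theorem vec_append {T : Type} [DecidableEq T] (l l' : List T) : vec (l ++ l') = vec l + vec l' := by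
  funext τ; simp [vec]

/-- Count an edge of type `τ`, and increment the loop counters. In the end these hold the number of
edges, which bounds the coefficients that the search has to consider. -/
def emitEdge (τ : Bool × P' × Finset N') :
    DProg (Bool × P' × Finset N') m Q N' (Bool × P' × Finset N') :=
  seqs (incr τ :: (List.finRange (m + 1)).map fun j => .push (.tok j) fun _ => .close)

/-- Count an edge if a condition holds. -/
def emitIf (c : Reg Q N' → Bool) (g : Reg Q N' → Bool × P' × Finset N') :
    DProg (Bool × P' × Finset N') m Q N' (Bool × P' × Finset N') :=
  .ite c (.case g emitEdge) (.load id)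

/-- Count the edges at the input node that come from the current triple. -/
def emit (predOf : Q → P') : DProg (Bool × P' × Finset N') m Q N' (Bool × P' × Finset N') :=
  seqs [emitIf (fun s => s.srcIsNode) fun s => (true, predOf s.pred, s.names),
    emitIf (fun s => s.isNode) fun s => (false, predOf s.pred, s.srcNames)]

/-- Look up the next term of `tri`: put the names that are assigned to it into `names`, and whether it
is the input node into `isNode`. -/
def lookupNext {T ι : Type} [DecidableEq T] (q₀ : Q) (δ : Q → Sym → Q) (nameOf : Q → Option N') :
    DProg T m Q N' ι :=
  seqs [read q₀ δ .tri .tmp, lookup q₀ δ nameOf, clear .reg, clear .tmp]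

/-- Count the edges at the input node that come from the next triple of `tri`. -/
def countTriple (q₀ : Q) (δ : Q → Sym → Q) (nameOf : Q → Option N') (predOf : Q → P') :
    DProg (Bool × P' × Finset N') m Q N' (Bool × P' × Finset N') :=
  seqs [lookupNext q₀ δ nameOf,
    .load fun s => { s with srcNames := s.names, srcIsNode := s.isNode },
    read q₀ δ .tri .tmp, .load fun s => { s with pred := s.q }, clear .tmp,
    lookupNext q₀ δ nameOf, emit predOf]

theorem runs_emitEdge {z : Bool × P' × Finset N' → ℤ} {t u : Fin (m + 1) → ℕ}
    (τ : Bool × P' × Finset N') (s : Reg Q N') :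
    Runs (emitEdge τ) (s, stk w z t u)
      ({ s with sym := none }, stk w (z + Pi.single τ 1) (fun j => t j + 1) u) (m + 8) := by
  have key : ∀ (js : List (Fin (m + 1))) (s : Reg Q N') (t : Fin (m + 1) → ℕ),
      Runs (seqs (js.map fun j => .push (.tok j) fun _ => .close) :
          DProg (Bool × P' × Finset N') m Q N' (Bool × P' × Finset N'))
        (s, stk w (z + Pi.single τ 1) t u)
        (s, stk w (z + Pi.single τ 1) (fun j => t j + js.count j) u) (js.length + 1) := by
    intro js
    induction js with
    | nil => exact fun s t => by simpa using Runs.seqs_nil le_rfl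
    | cons i js ih =>
      intro s t
      refine .seqs_cons (.push _ _ _ _ 1 le_rfl) (t₂ := js.length + 1) ?_
        (by simp only [List.length_cons]; omega)
      have h := ih s (Function.update t i (t i + 1))
      have e : (fun j => Function.update t i (t i + 1) j + js.count j) =
          fun j => t j + (i :: js).count j := by
        funext j
        by_cases hj : j = i
        · subst hj; simp only [Function.update_self, List.count_cons_self]; omega
        · simp [hj, Ne.symm hj]
      rwa [← update_tok, e] at h
  refine .seqs_cons (runs_incr τ s) (t₂ := m + 2) ?_ (by omega)
  have h := key (List.finRange (m + 1)) { s with sym := none } t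
  simpa [List.count_eq_one_of_mem (List.nodup_finRange (m + 1)) (List.mem_finRange _)] using h

theorem runs_emitIf {z : Bool × P' × Finset N' → ℤ} {n : ℕ} {u : Fin (m + 1) → ℕ}
    (c : Reg Q N' → Bool) (g : Reg Q N' → Bool × P' × Finset N') (s : Reg Q N') :
    ∃ y, Runs (emitIf c g) (s, stk w z (fun _ => n) u) ({ s with sym := y },
      stk w (z + vec (if c s then [g s] else []))
        (fun _ => n + (if c s then [g s] else []).length) u) (m + 10) := by
  cases h : c s with
  | false =>
    refine ⟨s.sym, .ite_false h (t₁ := 1) ?_ (by omega)⟩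
    simpa using Runs.load id s (stk w z (fun _ => n) u) 1 le_rfl
  | true =>
    refine ⟨none, .ite_true h (.case (t₁ := m + 8) ?_ le_rfl) le_rfl⟩
    simpa [vec_cons] using runs_emitEdge (w := w) (z := z) (t := fun _ => n) (u := u) (g s) s

theorem runs_emit {z : Bool × P' × Finset N' → ℤ} {n : ℕ} {u : Fin (m + 1) → ℕ} (s : Reg Q N')
    {τs : List (Bool × P' × Finset N')}
    (hτs : τs = (if s.srcIsNode then [(true, predOf s.pred, s.names)] else []) ++
      if s.isNode then [(false, predOf s.pred, s.srcNames)] else []) :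
    ∃ s', s'.ok = s.ok ∧ Runs (emit predOf) (s, stk w z (fun _ => n) u)
      (s', stk w (z + vec τs) (fun _ => n + τs.length) u) (2 * m + 21) := by
  subst hτs
  obtain ⟨y₁, h1⟩ := runs_emitIf (w := w) (z := z) (n := n) (u := u) (fun s => s.srcIsNode)
    (fun s => (true, predOf s.pred, s.names)) s
  obtain ⟨y₂, h2⟩ := runs_emitIf (w := w)
    (z := z + vec (if s.srcIsNode then [(true, predOf s.pred, s.names)] else []))
    (n := n + (if s.srcIsNode then [(true, predOf s.pred, s.names)] else []).length) (u := u)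
    (fun s => s.isNode) (fun s => (false, predOf s.pred, s.srcNames)) { s with sym := y₁ }
  refine ⟨{ s with sym := y₂ }, rfl, .seqs_cons h1 (t₂ := m + 11) ?_ (by omega)⟩
  rw [vec_append, ← add_assoc, List.length_append, ← add_assoc]
  exact .seqs_cons h2 (.seqs_nil (t := 1) le_rfl) le_rfl

/-- The type of an edge as it is computed by the program. -/
noncomputable def edgeType [Fintype N'] (κ : Coding I L B N) (q₀ : Q) (δ : Q → Sym → Q)
    (nameOf : Q → Option N') (predOf : Q → P') (pairs : List (N × Term I L B)) :
    Edge I L B → Bool × P' × Finset N' :=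
  Edge.type (fun p => predOf (runWord q₀ δ (κ.iri p)))
    (labels (fun n => nameOf (runWord q₀ δ (κ.name n))) pairs)

theorem runs_lookupNext {T ι : Type} [DecidableEq T] [Fintype N'] {z : T → ℤ}
    {t u : Fin (m + 1) → ℕ} (node v : Term I L B) (pairs : List (N × Term I L B)) (M : ℕ)
    (rest : List Sym) (inp : List Sym) (s : Reg Q N')
    (hinp : inp = encodeTerm κ node ++ pairs.flatMap (encodePair κ)) (hM : inp.length ≤ M)
    (hv : (encodeTerm κ v).length ≤ M) :
    ∃ s', s'.names = labels (fun n => nameOf (runWord q₀ δ (κ.name n))) pairs v ∧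
      (s'.isNode = true ↔ node = v) ∧ s.Keeps s' ∧
      Runs (lookupNext q₀ δ nameOf : DProg T m Q N' ι)
        (s, stk ⟨inp, encodeTerm κ v ++ rest, [], [], []⟩ z t u)
        (s', stk ⟨inp, rest, [], [], []⟩ z t u) ((3 * M + 60) * (M + 1) + 8 * M + 14) := by
  obtain ⟨q, h1⟩ := runs_read_term (ι := ι) (q₀ := q₀) (δ := δ) (k := (.tri : Stk T m)) (k' := .tmp)
    (by simp) v rest s (stk ⟨inp, encodeTerm κ v ++ rest, [], [], []⟩ z t u) rfl
  obtain ⟨s₂, x, y, hxy, hnames, hnode, hk, h2⟩ := runs_lookup (ι := ι) (q₀ := q₀) (δ := δ)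
    (nameOf := nameOf) (m := m) (z := z) (t := t) (u := u) node v pairs
    ⟨inp, rest, [], (encodeTerm κ v).reverse, []⟩ { s with sym := some .close, q := q } hinp rfl
    (by simp)
  have h3 := runs_clear (ι := ι) (.reg : Stk T m) s₂ (stk ⟨inp, rest, x, y, []⟩ z t u)
  have h4 := runs_clear (ι := ι) (.tmp : Stk T m) { s₂ with sym := none }
    (stk ⟨inp, rest, [], y, []⟩ z t u)
  rw [update_reg] at h3
  rw [update_tmp] at h4
  refine ⟨{ s₂ with sym := none }, hnames, hnode, ⟨hk.pred, hk.srcNames, hk.srcIsNode, hk.ok⟩,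
    .seqs_cons (by simpa [stk] using h1) (.seqs_cons h2 (.seqs_cons h3 (.seqs_cons h4
      (.seqs_nil (t := 1) le_rfl) le_rfl) le_rfl) le_rfl) ?_⟩
  have hlen := congrArg List.length hxy
  have := Nat.mul_le_mul (by omega : 3 * (encodeTerm κ v).length + 60 ≤ 3 * M + 60)
    (by omega : inp.length + 1 ≤ M + 1)
  simp only [List.length_append, List.length_reverse] at hlen
  simp only [stk]
  omega

/-- A bound for the time to process a triple, in terms of the length of the input. -/
def countTripleTime (m M : ℕ) : ℕ := 2 * ((3 * M + 60) * (M + 1)) + 24 * M + 2 * m + 70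

/-- The types of the edges at the node that come from the triple are added to the counts: the edge is
labelled by the names of the object, the inverse edge by those of the subject. -/
theorem runs_countTriple [Fintype N'] {z : Bool × P' × Finset N' → ℤ} {n : ℕ}
    {u : Fin (m + 1) → ℕ} (node : Term I L B) (tr : Triple I L B)
    (pairs : List (N × Term I L B)) (M : ℕ) (rest : List Sym) (inp : List Sym) (s : Reg Q N')
    (hinp : inp = encodeTerm κ node ++ pairs.flatMap (encodePair κ)) (hM : inp.length ≤ M)
    (htr : (encodeTriple κ tr).length ≤ M) :
    ∃ s', s'.ok = s.ok ∧ Runs (countTriple q₀ δ nameOf predOf)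
      (s, stk ⟨inp, encodeTerm κ tr.source ++ encodeWord (κ.iri tr.pred) ++ encodeTerm κ tr.obj ++
        rest, [], [], []⟩ z (fun _ => n) u)
      (s', stk ⟨inp, rest, [], [], []⟩
        (z + vec ((tr.edgesAt node).map (edgeType κ q₀ δ nameOf predOf pairs)))
        (fun _ => n + ((tr.edgesAt node).map (edgeType κ q₀ δ nameOf predOf pairs)).length) u)
      (countTripleTime m M) := by
  simp only [encodeTriple, List.length_cons, List.length_append] at htr
  obtain ⟨s₁, hnames₁, hnode₁, hk₁, h1⟩ := runs_lookupNext (z := z) (t := fun _ => n) (u := u)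
    (ι := Bool × P' × Finset N') (q₀ := q₀) (δ := δ) (nameOf := nameOf) node tr.source pairs M
    (encodeWord (κ.iri tr.pred) ++ (encodeTerm κ tr.obj ++ rest)) inp s hinp hM (by omega)
  have h2 := runs_read_word (ι := Bool × P' × Finset N') (q₀ := q₀) (δ := δ)
    (k := (.tri : Stk (Bool × P' × Finset N') m)) (k' := .tmp) (by simp) (κ.iri tr.pred)
    (encodeTerm κ tr.obj ++ rest) { s₁ with srcNames := s₁.names, srcIsNode := s₁.isNode }
    (stk ⟨inp, encodeWord (κ.iri tr.pred) ++ (encodeTerm κ tr.obj ++ rest), [], [], []⟩ z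
      (fun _ => n) u) rfl
  set p := runWord q₀ δ (κ.iri tr.pred) with hp
  set s₂ : Reg Q N' :=
    { s₁ with srcNames := s₁.names, srcIsNode := s₁.isNode, sym := some .close, q := p, pred := p }
    with hs₂
  have h3 := runs_clear (ι := Bool × P' × Finset N') (.tmp : Stk (Bool × P' × Finset N') m) s₂
    (stk ⟨inp, encodeTerm κ tr.obj ++ rest, [], (encodeWord (κ.iri tr.pred)).reverse, []⟩ z
      (fun _ => n) u)
  rw [update_tmp] at h3
  obtain ⟨s₄, hnames₄, hnode₄, hk₄, h4⟩ := runs_lookupNext (z := z) (t := fun _ => n) (u := u)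
    (ι := Bool × P' × Finset N') (q₀ := q₀) (δ := δ) (nameOf := nameOf) node tr.obj pairs M
    rest inp { s₂ with sym := none } hinp hM (by omega)
  obtain ⟨s₅, hs₅, h5⟩ := runs_emit (m := m) (w := ⟨inp, rest, [], [], []⟩) (z := z) (n := n) (u := u)
    (predOf := predOf) s₄
    (τs := (tr.edgesAt node).map (edgeType κ q₀ δ nameOf predOf pairs)) (by
      classical
      have e1 : s₄.srcIsNode = true ↔ node = tr.source := hk₄.srcIsNode ▸ hnode₁
      have e2 : s₄.srcNames = _ := hk₄.srcNames.trans hnames₁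
      have e3 : s₄.pred = p := hk₄.pred
      simp only [Triple.edgesAt, List.map_append, apply_ite (List.map _), List.map_nil,
        List.map_singleton, e1, hnode₄, e2, e3, hnames₄]
      rfl)
  refine ⟨s₅, hs₅.trans (hk₄.ok.trans hk₁.ok), ?_⟩
  simp only [List.append_assoc]
  refine .seqs_cons h1 (.seqs_cons (.load _ _ _ 1 le_rfl) (.seqs_cons (by simpa [stk] using h2)
    (.seqs_cons (.load _ _ _ 1 le_rfl) (.seqs_cons h3 (.seqs_cons h4 (.seqs_cons h5
      (.seqs_nil (t := 1) le_rfl) le_rfl) le_rfl) le_rfl) le_rfl) le_rfl) le_rfl) ?_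
  simp only [stk, countTripleTime, List.length_reverse]
  omega

/-- Count the edges at the input node that come from the triples of `tri`. -/
def countTriples (q₀ : Q) (δ : Q → Sym → Q) (nameOf : Q → Option N') (predOf : Q → P') :
    DProg (Bool × P' × Finset N') m Q N' (Bool × P' × Finset N') :=
  forEach .tri (countTriple q₀ δ nameOf predOf)

theorem runs_countTriples [Fintype N'] {z : Bool × P' × Finset N' → ℤ} {n : ℕ}
    {u : Fin (m + 1) → ℕ} (node : Term I L B) (trs : List (Triple I L B))
    (pairs : List (N × Term I L B)) (M : ℕ) (inp : List Sym) (s : Reg Q N')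
    (hinp : inp = encodeTerm κ node ++ pairs.flatMap (encodePair κ)) (hM : inp.length ≤ M)
    (htrs : ∀ tr ∈ trs, (encodeTriple κ tr).length ≤ M)
    {τs : List (Bool × P' × Finset N')}
    (hτs : τs = (trs.flatMap (Triple.edgesAt node)).map (edgeType κ q₀ δ nameOf predOf pairs)) :
    ∃ s', s'.ok = s.ok ∧ Runs (countTriples q₀ δ nameOf predOf)
      (s, stk ⟨inp, trs.flatMap (encodeTriple κ), [], [], []⟩ z (fun _ => n) u)
      (s', stk ⟨inp, [], [], [], []⟩ (z + vec τs) (fun _ => n + τs.length) u)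
      (trs.length * (countTripleTime m M + 2) + 2) := by
  subst hτs
  induction trs generalizing s z n with
  | nil => exact ⟨{ s with sym := none }, rfl, by simpa [countTriples] using forEach_nil rfl⟩
  | cons tr trs ih =>
    obtain ⟨s₁, hs₁, h1⟩ := runs_countTriple (m := m) (z := z) (n := n) (u := u) (q₀ := q₀) (δ := δ)
      (nameOf := nameOf) (predOf := predOf) node tr pairs M (trs.flatMap (encodeTriple κ)) inp
      { s with sym := some .triple } hinp hM (htrs tr List.mem_cons_self)
    obtain ⟨s₂, hs₂, h2⟩ := ih (z := z + vec ((tr.edgesAt node).map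
      (edgeType κ q₀ δ nameOf predOf pairs))) (n := n + ((tr.edgesAt node).map
      (edgeType κ q₀ δ nameOf predOf pairs)).length) s₁
      fun tr' h => htrs tr' (List.mem_cons_of_mem _ h)
    refine ⟨s₂, hs₂.trans hs₁, ?_⟩
    rw [add_assoc, ← vec_append, Nat.add_assoc, ← List.length_append, ← List.map_append,
      ← List.flatMap_cons] at h2
    refine forEach_cons (a := .triple) (l := encodeTerm κ tr.source ++ encodeWord (κ.iri tr.pred) ++
      encodeTerm κ tr.obj ++ trs.flatMap (encodeTriple κ)) ?_ ?_ h2 (t₁ := countTripleTime m M) ?_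
    · simp [stk, encodeTriple]
    · rw [update_tri]
      exact h1
    · simp only [List.length_cons]
      linarith

end ShEx

/-! ### The decision program -/

namespace ShEx

open Prog

section Recognition

theorem take_take_append {A : Type} (k : ℕ) (l l' : List A) :
    (l.take k ++ l').take k = (l ++ l').take k := by
  rcases le_total l.length k with h | h
  · rw [List.take_of_length_le h]
  · rw [List.take_append_of_le_length (by simp [h]), List.take_append_of_le_length h, List.take_take,
      min_self]

/-- A finite automaton can identify finitely many words: it stores a prefix that is longer than all
of them. -/
theorem exists_automaton {W : Set (List Bool)} (hW : W.Finite) :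
    ∃ (Q : Type) (_ : Finite Q) (q₀ : Q) (δ : Q → Sym → Q),
      ∀ w ∈ W, ∀ w', runWord q₀ δ w' = runWord q₀ δ w → w' = w := by
  obtain ⟨k, hk⟩ := (hW.image List.length).bddAbove
  let δ : {l : List Bool // l.length ≤ k + 1} → Sym → {l : List Bool // l.length ≤ k + 1} := fun q a =>
    match a with
    | .bit b => ⟨(q.1 ++ [b]).take (k + 1), List.length_take_le _ _⟩
    | _ => q
  have key : ∀ (w : List Bool) q, ((w.map Sym.bit).foldl δ q).1 = (q.1 ++ w).take (k + 1) := by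
    intro w
    induction w with
    | nil => exact fun q => by simp [List.take_of_length_le q.2]
    | cons b w ih =>
      intro q
      rw [List.map_cons, List.foldl_cons, ih, take_take_append]
      simp
  refine ⟨_, (List.finite_length_le Bool (k + 1)).to_subtype, ⟨[], by simp⟩, δ, fun w hw w' h => ?_⟩
  have hlen : w.length ≤ k := hk ⟨w, hw, rfl⟩
  have h' := congrArg Subtype.val h
  have e : ∀ w : List Bool, (runWord ⟨[], by simp⟩ δ w).1 = w.take (k + 1) := fun w => by
    rw [runWord, encodeWord, List.foldl_append]
    exact key w _
  rw [e, e, List.take_of_length_le (l := w) (by omega)] at h'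
  have h2 := congrArg List.length h'
  rw [List.length_take] at h2
  rwa [List.take_of_length_le (by omega)] at h'

/-- The state after the code of a relevant element determines this element, and differs from the states
after the codes of all others. -/
theorem exists_decoder {Q A : Type} {q₀ : Q} {δ : Q → Sym → Q} {c : A → List Bool}
    (hc : Function.Injective c) (X : Set A)
    (h : ∀ a ∈ X, ∀ w', runWord q₀ δ w' = runWord q₀ δ (c a) → w' = c a) :
    ∃ f : Q → Option X, ∀ a (x : X), f (runWord q₀ δ (c a)) = some x ↔ a = x := by
  classical
  refine ⟨fun q => if h : ∃ x : X, runWord q₀ δ (c x) = q then some h.choose else none,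
    fun a x => ?_⟩
  constructor
  · intro hx
    by_cases hq : ∃ x : X, runWord q₀ δ (c x) = runWord q₀ δ (c a)
    · simp only [dif_pos hq, Option.some.injEq] at hx
      have h1 := hq.choose_spec
      rw [hx] at h1
      exact hc (h x x.2 _ h1.symm)
    · simp only [dif_neg hq, reduceCtorEq] at hx
  · rintro rfl
    have hq : ∃ y : X, runWord q₀ δ (c y) = runWord q₀ δ (c x) := ⟨x, rfl⟩
    simp only [dif_pos hq, Option.some.injEq]
    exact Subtype.ext (hc (h _ hq.choose.2 _ hq.choose_spec.symm)).symm

end Recognition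

section Decision

variable {I L B V N : Type} {P' N' Q : Type} {m : ℕ} [Fintype P'] [Fintype N'] {q₀ : Q} {δ : Q → Sym → Q}
  {nameOf : Q → Option N'} {predOf : Q → P'} {κ : Coding I L B N} [DecidableEq P'] [DecidableEq N']

/-- The decision program: split the input into the triples on the one hand, the node and the pairs
on the other hand, count the edges at the node by type, and search for a representation of the
counts. -/
noncomputable def decision (q₀ : Q) (δ : Q → Sym → Q) (nameOf : Q → Option N') (predOf : Q → P')
    (F : List (List (Bool × P' × Finset N') × List (List (Bool × P' × Finset N')))) :
    DProg (Bool × P' × Finset N') m Q N' (Bool × P' × Finset N') :=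
  seqs [read q₀ δ .inp .tmp, split, moveAll .tmp .inp, moveAll .done .tri,
    countTriples q₀ δ nameOf predOf, searchAll F]

theorem vec_le_length {T : Type} [DecidableEq T] (l : List T) (τ : T) : vec l τ ≤ l.length :=
  Int.ofNat_le.2 List.count_le_length

theorem length_le_length_flatMap {A A' : Type} {f : A → List A'} {l : List A} {a : A} (h : a ∈ l) :
    (f a).length ≤ (l.flatMap f).length := by
  induction l with
  | nil => cases h
  | cons b l ih =>
    rw [List.flatMap_cons, List.length_append]
    rcases List.mem_cons.1 h with rfl | h
    · omega
    · have := ih h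
      omega

theorem length_flatMap_le_mul {A A' : Type} {f : A → List A'} {k : ℕ} (l : List A)
    (h : ∀ a, (f a).length ≤ k) : (l.flatMap f).length ≤ k * l.length := by
  induction l with
  | nil => simp
  | cons b l ih =>
    rw [List.flatMap_cons, List.length_append, List.length_cons, Nat.mul_succ]
    have := h b
    omega

theorem length_le_length_flatMap_of_pos {A A' : Type} {f : A → List A'} (l : List A)
    (h : ∀ a, 1 ≤ (f a).length) : l.length ≤ (l.flatMap f).length := by
  induction l with
  | nil => simp
  | cons b l ih =>
    rw [List.flatMap_cons, List.length_append, List.length_cons]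
    have := h b
    omega

/-- A bound for the running time of the decision program on an input of length `n`, except for the
search. -/
def decisionTime (m n : ℕ) : ℕ := 15 * n + 20 + (n * (countTripleTime m n + 2) + 2)

theorem decisionTime_le (m n : ℕ) : decisionTime m n ≤ (400 + 2 * m) * (n + 1) ^ 3 := by
  simp only [decisionTime, countTripleTime]
  nlinarith [Nat.zero_le (m * n), Nat.zero_le (m * n ^ 2), Nat.zero_le (m * n ^ 3),
    Nat.zero_le (n ^ 2), Nat.zero_le (n ^ 3)]

/-- The program answers whether the search succeeds on the counts of the edge types at the node. -/
theorem runs_decision {C : Catalogue I L V N} (x : MatchInput B C)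
    (F : List (List (Bool × P' × Finset N') × List (List (Bool × P' × Finset N'))))
    (hF : ∀ y ∈ F, y.2.length ≤ m) (s : Reg Q N') {τs : List (Bool × P' × Finset N')}
    (hτs : τs = (x.triples.flatMap (Triple.edgesAt x.node)).map
      (edgeType κ q₀ δ nameOf predOf x.pairs)) :
    ∃ st, (st.1.ok = true ↔ s.ok = true ∨ ∃ y ∈ F, InSpan τs.length y.2 (vec τs - vec y.1)) ∧
      Runs (decision q₀ δ nameOf predOf F : DProg (Bool × P' × Finset N') m Q N' _)
        (s, Function.update (fun _ => []) .inp (x.encode κ)) st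
        (decisionTime m (x.encode κ).length + searchAllTime τs.length F) := by
  set A := encodeTerm κ x.node with hA
  set D := x.triples.flatMap (encodeTriple κ) with hD
  set E := x.pairs.flatMap (encodePair κ) with hE
  have henc : x.encode κ = A ++ (D ++ E) := by simp [MatchInput.encode, A, D, E]
  have hE' : E = [] ∨ ∃ r, E = .pair :: r := by
    rw [hE]
    cases x.pairs with
    | nil => exact .inl rfl
    | cons p l => exact .inr ⟨_, rfl⟩
  have hD' : Sym.pair ∉ D := by
    simp only [hD, List.mem_flatMap, not_exists, not_and]
    exact fun tr _ => pair_notMem_encodeTriple κ tr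
  have e0 : (Function.update (fun _ => []) .inp (x.encode κ) : Stk (Bool × P' × Finset N') m → _) =
      stk ⟨x.encode κ, [], [], [], []⟩ 0 (fun _ => 0) fun _ => 0 := by
    funext k
    cases k <;> simp [stk]
  obtain ⟨q, h1⟩ := runs_read_term (ι := Bool × P' × Finset N') (q₀ := q₀) (δ := δ)
    (k := (.inp : Stk (Bool × P' × Finset N') m)) (k' := .tmp) (by simp) x.node (D ++ E) s
    (stk ⟨x.encode κ, [], [], [], []⟩ 0 (fun _ => 0) fun _ => 0) henc
  obtain ⟨y, h2⟩ := runs_split (T := Bool × P' × Finset N') (ι := Bool × P' × Finset N') (m := m)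
    (w := ⟨D ++ E, [], [], A.reverse, []⟩) (z := 0) (t := fun _ => 0) (u := fun _ => 0)
    hD' hE' { s with sym := some .close, q := q } rfl
  have h3 := runs_moveAll (ι := Bool × P' × Finset N')
    (k := (.tmp : Stk (Bool × P' × Finset N') m)) (k' := .inp) (by simp)
    { s with sym := y, q := q } (stk ⟨E, [], [], A.reverse, D.reverse⟩ 0 (fun _ => 0) fun _ => 0)
  have h4 := runs_moveAll (ι := Bool × P' × Finset N')
    (k := (.done : Stk (Bool × P' × Finset N') m)) (k' := .tri) (by simp)
    { s with sym := none, q := q } (stk ⟨A ++ E, [], [], [], D.reverse⟩ 0 (fun _ => 0) fun _ => 0)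
  have hlen : (x.encode κ).length = A.length + (D.length + E.length) := by simp [henc]
  obtain ⟨s₅, hs₅, h5⟩ := runs_countTriples (m := m) (z := 0) (n := 0) (u := fun _ => 0) (q₀ := q₀)
    (δ := δ) (nameOf := nameOf) (predOf := predOf) x.node x.triples x.pairs (x.encode κ).length
    (A ++ E) { s with sym := none, q := q } rfl
    (by rw [List.length_append]; omega)
    (fun tr htr => by
      have := length_le_length_flatMap (f := encodeTriple κ) htr
      rw [← hD] at this
      omega) hτs
  obtain ⟨s₆, hs₆, h6⟩ := runs_searchAll (m := m) (w := ⟨A ++ E, [], [], [], []⟩) (z := vec τs)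
    (ι := Bool × P' × Finset N') τs.length F hF s₅
  rw [zero_add] at h5
  simp only [Nat.zero_add] at h5
  refine ⟨(s₆, stk ⟨A ++ E, [], [], [], []⟩ (vec τs) (fun _ => τs.length) fun _ => 0), ?_, ?_⟩
  · rw [hs₆, hs₅]
  · rw [e0]
    refine .seqs_cons h1 (.seqs_cons (by simpa [stk] using h2) (.seqs_cons h3 (.seqs_cons
      (by simpa [stk] using h4) (.seqs_cons (by simpa [stk] using h5) (.seqs_cons h6
        (.seqs_nil (t := 1) le_rfl) le_rfl) le_rfl) le_rfl) le_rfl) le_rfl) ?_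
    have hX : x.triples.length ≤ (x.encode κ).length :=
      (length_le_length_flatMap_of_pos x.triples fun tr => by simp [encodeTriple]).trans
        (by omega : D.length ≤ _)
    have := Nat.mul_le_mul_right (countTripleTime m (x.encode κ).length + 2) hX
    simp only [decisionTime, stk, List.length_reverse, ← hA]
    omega

end Decision

section

variable {I L B V N : Type}

/-- The time is bounded by a polynomial in the length of the input: each triple is looked up in a time
quadratic in the length, there are at most twice as many edges at the node as triples, and the search
is polynomial in their number. -/
theorem computableInPolyTime_answer (κ : Coding I L B N) (val : V → Set (Term I L B))
    (C : Catalogue I L V N) (e : TripleExpr I L V N) (hshallow : e.IsShallow) :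
    Nonempty (Turing.TM2ComputableInPolyTime (fun x : MatchInput B C => x.encode κ)
      Computability.encodeBool (fun x : MatchInput B C => x.answer val e)) := by
  classical
  -- The relevant predicates and names, and the automaton that recognizes their codes.
  have hN := hshallow.finite_names
  have hP := e.finite_preds
  obtain ⟨Q, _, q₀, δ, hQ⟩ := exists_automaton ((hP.image κ.iri).union (hN.image κ.name))
  obtain ⟨predOf, hpred⟩ := exists_decoder κ.iri_injective e.preds
    fun p hp w' => hQ _ (.inl ⟨p, hp, rfl⟩) w'
  obtain ⟨nameOf, hname⟩ := exists_decoder κ.name_injective e.names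
    fun n hn w' => hQ _ (.inr ⟨n, hn, rfl⟩) w'
  have := hN.fintype
  have := hP.fintype
  -- Edges are typed by the classes of their predicates, where all irrelevant predicates are in the
  -- class `none`, and by the relevant names that are assigned to their targets.
  let cls : I → Option e.preds := fun p => predOf (runWord q₀ δ (κ.iri p))
  let mem : N → Finset e.names → Prop := fun s l => ∃ h : s ∈ e.names, ⟨s, h⟩ ∈ l
  obtain ⟨F, hF⟩ := exists_search_of_isSemilinearSet (e.isSemilinearSet_counts cls mem)
  obtain ⟨c, d, hcd⟩ := exists_searchAllTime_le F
  -- `m` bounds the depth of the nested loops.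
  obtain ⟨m, hm⟩ : ∃ m, ∀ y ∈ F, y.2.length ≤ m :=
    ⟨(F.map fun y => y.2.length).sum, fun y hy => List.le_sum_of_mem (List.mem_map_of_mem hy)⟩
  let s₀ : Reg Q e.names :=
    { sym := none, aux := none, eq := false, q := q₀, pred := q₀, names := ∅, isNode := false,
        srcNames := ∅, srcIsNode := false, ok := false }
  refine computableInPolyTime (K := Stk (Bool × Option e.preds × Finset e.names) m) _ _
    (decision q₀ δ nameOf predOf F) .inp s₀ Reg.ok
    (400 + 2 * m + c * 2 ^ d) (3 + d) fun x => ?_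
  set n := (x.encode κ).length with hn
  set τs := (x.triples.flatMap (Triple.edgesAt x.node)).map
    (edgeType κ q₀ δ nameOf predOf x.pairs) with hτs
  obtain ⟨st, hst, hR⟩ := runs_decision (κ := κ) x F hm s₀ hτs
  refine ⟨st, hR.mono ?_, ?_⟩
  · have hlen : τs.length ≤ 2 * n := by
      rw [hτs, List.length_map]
      refine (length_flatMap_le_mul _ (Triple.length_edgesAt_le x.node)).trans
        (Nat.mul_le_mul_left 2 ?_)
      refine (length_le_length_flatMap_of_pos (f := encodeTriple κ) _
        fun tr => by simp [encodeTriple]).trans ?_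
      simp only [hn, MatchInput.encode, List.length_append]
      omega
    calc decisionTime m n + searchAllTime τs.length F
        ≤ (400 + 2 * m) * (n + 1) ^ 3 + c * (2 * (n + 1)) ^ d :=
          Nat.add_le_add (decisionTime_le m n) ((hcd _).trans
            (Nat.mul_le_mul_left c (Nat.pow_le_pow_left (by omega) d)))
      _ ≤ (400 + 2 * m) * (n + 1) ^ (3 + d) + c * 2 ^ d * (n + 1) ^ (3 + d) := by
          rw [mul_pow, ← mul_assoc]
          gcongr <;> omega
      _ = _ := (add_mul _ _ _).symm
  · have hsem : x.Matches val e ↔ ∃ y ∈ F, InSpan τs.length y.2 (vec τs - vec y.1) := by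
      have hcount : (fun τ => (typeCount (edgeType κ q₀ δ nameOf predOf x.pairs)
          (x.graph.neigh x.node) τ : ℤ)) = vec τs := funext fun τ => by
        rw [MatchInput.graph, Graph.neigh_eq x.triples_nodup,
          typeCount_eq_count (Triple.nodup_flatMap_edgesAt x.triples_nodup x.node)]
        rfl
      rw [MatchInput.Matches, neigh_mem_sem_iff (cls := cls) (mem := mem)
        (lab := labels (fun n => nameOf (runWord q₀ δ (κ.name n))) x.pairs) hshallow, hF _ τs.length]
      · rw [← hcount]
        rfl
      · intro τ
        have h := vec_le_length τs τ
        rw [← hcount] at h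
        exact Int.ofNat_le.1 h
      · intro p hp q hq
        exact (hpred q ⟨p, hp⟩).1 (hq.trans ((hpred p ⟨p, hp⟩).2 rfl))
      · intro s hs u
        simp only [MatchInput.assignment, Set.mem_ofPred_eq, mem, labels, hname, exists_prop, hs,
          Finset.mem_filter, Finset.mem_univ, true_and]
        constructor
        · exact fun h => ⟨(s, u), h, rfl, rfl⟩
        · rintro ⟨⟨s', u'⟩, h, rfl, rfl⟩
          exact h
    rw [Bool.eq_iff_iff, hst, MatchInput.answer, decide_eq_true_iff, hsem]
    simp

end

end ShEx

/-- Fix a ShEx catalogue `C` and a shallow triple expression `e` that occurs in `C`. There is a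
multi-stack Turing machine that, given a graph, a shape assignment for it and `C`, and a node,
decides in time polynomial in the length of the input whether the neighbourhood of the node
matches `e`. -/
theorem mainTheorem5 {I L B V N : Type} [Finite V]
    (κ : ShEx.Coding I L B N)
    (val : V → Set (ShEx.Term I L B))
    (C : ShEx.Catalogue I L V N)
    (e : ShEx.TripleExpr I L V N)
    (he : e ∈ C.tripleExprs)
    (hshallow : e.IsShallow) :
    Nonempty (Turing.TM2ComputableInPolyTime
      (fun x : ShEx.MatchInput B C => x.encode κ)
      Computability.encodeBool
      (fun x : ShEx.MatchInput B C => x.answer val e)) :=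
  ShEx.computableInPolyTime_answer κ val C e hshallow
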